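/- Let $n\ge 0$ and $j\ge 0$ be integers and let $\mathcal T_n=\{x_i+x_j=0 \mid 1\le i<j\le n\}$ be the threshold arrangement in $\mathbb R^n$. Its characteristic polynomial is $$\chi_{\mathcal T_n}(t)=\sum_{x\in L(\mathcal T_n)}\mu(\hat 0,x)\,t^{\dim x},$$ where $L(\mathcal T_n)$ is the poset of all nonempty intersections of hyperplanes of $\mathcal T_n$ (including the empty intersection $\hat 0=\mathbb R^n$), ordered by reverse inclusion, and $\mu$ is its Möbius function. A signed permutation on $[n]=\{1,\dots,n\}$ is a permutation $\pi_1\pi_2\cdots\pi_n$ of $[n]$ written as a word, together with a sign $+$ or $-$ assigned to each $\pi_i$. It is split into compartments by drawing a line before the word and then repeatedly drawing a line right after the least number that comes after the last line drawn, until a line is drawn at the end; the compartments are the pieces between consecutive lines. An odd cycle is a compartment that contains an odd number of negative signs. A signed permutation is normal if every number with a positive sign, other than the first number of the word, is larger than the number right before it. A threshold permutation of size $n$ is a signed permutation on $[n]$ such that (i) the first number is less than the second; (ii) if the first number is $1$, it has a negative sign; (iii) if the first number is not $1$, the second number has a negative sign; (iv) it is normal. (Conditions that refer to a first or second number are void if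 there is no such number.) **Theorem.** The absolute value of the coefficient of $t^j$ in $\chi_{\mathcal T_n}(t)$ equals the number of threshold permutations of size $n$ with exactly $j$ odd cycles. Moreover, this number equals $N(n,j)-n\cdot N(n-1,j)$, where $N(m,j)$ denotes the number of normal permutations on $[m]$ with exactly $j$ odd cycles (for $n=0$ the term $n\cdot N(n-1,j)$ is read as $0$). -/

import Mathlib

/-- A hyperplane arrangement in `ℝⁿ`: a finite set of affine hyperplanes, that is, of nonempty affine
subspaces of codimension one. -/
structure HyperplaneArrangement (n : ℕ) where
  hyperplanes : Set (AffineSubspace ℝ (Fin n → ℝ))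
  finite : hyperplanes.Finite
  nonempty_of_mem : ∀ H ∈ hyperplanes, (H : Set (Fin n → ℝ)).Nonempty
  finrank_add_one_of_mem : ∀ H ∈ hyperplanes, Module.finrank ℝ H.direction + 1 = n

namespace HyperplaneArrangement

/-- `X` is a nonempty intersection of a (possibly empty) set of hyperplanes of `A`; the empty
intersection is the whole space. -/
def IsFlat {n : ℕ} (A : HyperplaneArrangement n) (X : AffineSubspace ℝ (Fin n → ℝ)) : Prop :=
  (X : Set (Fin n → ℝ)).Nonempty ∧ ∃ B ⊆ A.hyperplanes, X = sInf B

/-- The intersection poset of `A`, ordered by reverse inclusion (hence the order dual). -/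
abbrev IntersectionPoset {n : ℕ} (A : HyperplaneArrangement n) : Type :=
  {X : (AffineSubspace ℝ (Fin n → ℝ))ᵒᵈ // A.IsFlat (OrderDual.ofDual X)}

instance {n : ℕ} (A : HyperplaneArrangement n) : Finite A.IntersectionPoset := by
  have h : {X : AffineSubspace ℝ (Fin n → ℝ) | A.IsFlat X}.Finite := by
    refine (A.finite.finite_subsets.image sInf).subset ?_
    rintro X ⟨-, B, hB, rfl⟩
    exact ⟨B, hB, rfl⟩
  exact h.to_subtype

noncomputable instance {n : ℕ} (A : HyperplaneArrangement n) : Fintype A.IntersectionPoset :=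
  Fintype.ofFinite _

open Classical in
noncomputable instance {n : ℕ} (A : HyperplaneArrangement n) :
    LocallyFiniteOrder A.IntersectionPoset :=
  Fintype.toLocallyFiniteOrder

theorem isFlat_top {n : ℕ} (A : HyperplaneArrangement n) : A.IsFlat ⊤ :=
  ⟨⟨0, AffineSubspace.mem_top ℝ _ _⟩, ∅, Set.empty_subset _, sInf_empty.symm⟩

/-- The least element `0̂` of the intersection poset is the whole space `ℝⁿ`. -/
instance {n : ℕ} (A : HyperplaneArrangement n) : OrderBot A.IntersectionPoset where
  bot := ⟨OrderDual.toDual ⊤, A.isFlat_top⟩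
  bot_le X := le_top (a := OrderDual.ofDual X.1)

open Classical in
/-- The characteristic polynomial `χ_A(t) = ∑_{X ∈ L(A)} μ(0̂, X) t ^ dim X`. -/
noncomputable def charPoly {n : ℕ} (A : HyperplaneArrangement n) : Polynomial ℤ :=
  ∑ X : A.IntersectionPoset,
    Polynomial.C (IncidenceAlgebra.mu ℤ ⊥ X) *
      Polynomial.X ^ Module.finrank ℝ (OrderDual.ofDual X.1).direction

end HyperplaneArrangement

/-- The linear form `x_i + x_j` on `ℝⁿ`. -/
def sumForm {n : ℕ} (i j : Fin n) : (Fin n → ℝ) →ₗ[ℝ] ℝ :=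
  (LinearMap.proj i : (Fin n → ℝ) →ₗ[ℝ] ℝ) + (LinearMap.proj j : (Fin n → ℝ) →ₗ[ℝ] ℝ)

/-- The set `{x ∈ ℝⁿ | x_i + x_j = 0}`, as an affine subspace. -/
def sumZeroSubspace {n : ℕ} (i j : Fin n) : AffineSubspace ℝ (Fin n → ℝ) :=
  (LinearMap.ker (sumForm i j)).toAffineSubspace

/-- The threshold arrangement `{x_i + x_j = 0 | i < j}` in `ℝⁿ`. -/
def thresholdArrangement (n : ℕ) : HyperplaneArrangement n where
  hyperplanes := {H | ∃ i j : Fin n, i < j ∧ H = sumZeroSubspace i j}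
  finite := by
    refine (Set.finite_range fun p : Fin n × Fin n => sumZeroSubspace p.1 p.2).subset ?_
    rintro H ⟨i, j, -, rfl⟩
    exact ⟨(i, j), rfl⟩
  nonempty_of_mem := by
    rintro H ⟨i, j, -, rfl⟩
    exact ⟨0, by simp [sumZeroSubspace]⟩
  finrank_add_one_of_mem := by
    rintro H ⟨i, j, hij, rfl⟩
    have hne : sumForm i j ≠ 0 := by
      intro h
      have h1 := LinearMap.congr_fun h (Pi.single i 1)
      simp [sumForm, hij.ne'] at h1
    have h2 := Module.Dual.finrank_ker_add_one_of_ne_zero hne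
    rw [sumZeroSubspace, Submodule.toAffineSubspace_direction]
    simpa using h2

/-- A signed permutation on `[n]`: the pair `(π, w)` stands for the word `π 0, π 1, …` in which the
number at position `i` carries the sign `w i`. Positions and numbers are indexed from `0`, so that
the element `k` of `Fin n` plays the role of the number `k + 1` of `[n]`. -/
abbrev SignedPerm (n : ℕ) : Type := Equiv.Perm (Fin n) × (Fin n → ℤˣ)

namespace SignedPerm

/-- The number at position `i` is the least among those at positions `≥ a`. -/
def IsLeastFrom {n : ℕ} (p : SignedPerm n) (a : ℕ) (i : Fin n) : Prop :=
  a ≤ i.val ∧ ∀ k : Fin n, a ≤ k.val → p.1 i ≤ p.1 k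

/-- `p.IsLine a` says that a line is drawn right before position `a` (for `a = n`: at the end):
one line is drawn before the word, and then repeatedly a line is drawn right after the least number
that comes after the last line drawn. -/
inductive IsLine {n : ℕ} (p : SignedPerm n) : ℕ → Prop
  | start : IsLine p 0
  | next (a : ℕ) (i : Fin n) : IsLine p a → p.IsLeastFrom a i → IsLine p (i.val + 1)

/-- A compartment, as a set of positions: the positions between a line and the next line. -/
def IsCompartment {n : ℕ} (p : SignedPerm n) (S : Finset (Fin n)) : Prop :=
  ∃ (a : ℕ) (i : Fin n), p.IsLine a ∧ p.IsLeastFrom a i ∧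
    S = Finset.univ.filter fun k : Fin n => a ≤ k.val ∧ k ≤ i

/-- The number of odd cycles: the number of compartments with an odd number of negative signs. -/
noncomputable def oddCycles {n : ℕ} (p : SignedPerm n) : ℕ :=
  Set.ncard {S : Finset (Fin n) | p.IsCompartment S ∧ Odd (S.filter fun k => p.2 k = -1).card}

/-- Normal permutations: any number with a positive sign is larger than the one right before it
(no condition on the sign of the first number). -/
def IsNormal {n : ℕ} (p : SignedPerm n) : Prop :=
  ∀ i j : Fin n, i.val + 1 = j.val → p.2 j = 1 → p.1 i < p.1 j

/-- Threshold permutations. The conditions that mention the second number are void if there is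
none. -/
structure IsThreshold {n : ℕ} (p : SignedPerm n) : Prop where
  first_lt_second : ∀ i j : Fin n, i.val = 0 → j.val = 1 → p.1 i < p.1 j
  sign_first : ∀ i : Fin n, i.val = 0 → (p.1 i).val = 0 → p.2 i = -1
  sign_second : ∀ i j : Fin n, i.val = 0 → j.val = 1 → (p.1 i).val ≠ 0 → p.2 j = -1
  lt_of_pos : ∀ i j : Fin n, i.val + 1 = j.val → p.2 j = 1 → p.1 i < p.1 j

end SignedPerm

/-- The number `N(n, j)` of normal permutations on `[n]` with exactly `j` odd cycles. -/
noncomputable def normalCount (n j : ℕ) : ℕ :=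
  Set.ncard {p : SignedPerm n | p.IsNormal ∧ p.oddCycles = j}

/-- The number of threshold permutations of size `n` with exactly `j` odd cycles. -/
noncomputable def thresholdCount (n j : ℕ) : ℕ :=
  Set.ncard {p : SignedPerm n | p.IsThreshold ∧ p.oddCycles = j}

/-! The characteristic polynomial and the threshold permutations are compared at infinitely many odd
integers.

On a flat every coordinate is 0 or plus or minus a free coordinate, so a flat of dimension d
contains (2m+1)^d integer points of the box [-m, m]^n. Möbius summation then shows that χ(2m+1)
counts the box points on no hyperplane (`eval_charPoly_thresholdArrangement`). Such a point has at
most one zero coordinate. Among its nonzero coordinates, those of a given absolute value 1, ..., m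
form a block of equal entries, with two possible signs if nonempty; so the exponential generating
function (egf) is (2e^x - 1)^m (`card_sepSet_eq_egfCoeff`).

Cutting a normal word at its least letter, which ends the first compartment, gives W' = (t+1) F W
for the egf W of t^(odd compartments), where F = 1/(2 - e^x) is the egf of half the number of normal
words, with constant term 1. At t = -(2m+1) the solution is (2e^(-x) - 1)^m (`wordSum_eq_egfCoeff`):
up to the sign (-1)^n this is the box count.

Finally, normal words that are not threshold words correspond to pairs of a first letter and a
normal word on the other letters, with the same number of odd compartments
(`sum_not_isThresholdWord`). This gives the term n N(n-1, j), which mirrors the box points with one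
zero coordinate. -/

section Words

/-! ### Signed words and the cut at the least letter -/

variable {α : Type*}

/-- The product of the signs of a signed word. -/
def wordSign (l : List (α × ℤˣ)) : ℤˣ := (l.map Prod.snd).prod

theorem append_cons_inj_of_fst_ne {a : α} {s s' : ℤˣ} :
    ∀ {u u' v v' : List (α × ℤˣ)}, (∀ x ∈ u, x.1 ≠ a) → (∀ x ∈ u', x.1 ≠ a) →
      u ++ (a, s) :: v = u' ++ (a, s') :: v' → u = u' ∧ s = s' ∧ v = v'
  | [], [], v, v', _, _, h => by simpa using h
  | [], x :: u', v, v', _, h2, h => by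
    simp only [List.nil_append, List.cons_append, List.cons.injEq] at h
    exact absurd (congrArg Prod.fst h.1).symm (h2 x (by simp))
  | x :: u, [], v, v', h1, _, h => by
    simp only [List.nil_append, List.cons_append, List.cons.injEq] at h
    exact absurd (congrArg Prod.fst h.1) (h1 x (by simp))
  | x :: u, x' :: u', v, v', h1, h2, h => by
    simp only [List.cons_append, List.cons.injEq] at h
    obtain ⟨h3, h4, h5⟩ := append_cons_inj_of_fst_ne (fun y hy => h1 y (by simp [hy]))
      (fun y hy => h2 y (by simp [hy])) h.2
    exact ⟨by rw [h.1, h3], h4, h5⟩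

/-- Change the sign of the first letter. -/
def flipHead : List (α × ℤˣ) → List (α × ℤˣ)
  | [] => []
  | x :: l => (x.1, -x.2) :: l

theorem flipHead_flipHead (l : List (α × ℤˣ)) : flipHead (flipHead l) = l := by
  cases l <;> simp [flipHead]

variable [LinearOrder α]

/-- The number of odd compartments of a signed word, where `c` is the product of the signs of those
letters of the first compartment that were read already. The last letter of a compartment is smaller
than all the letters after it. -/
def oddAux : ℤˣ → List (α × ℤˣ) → ℕ
  | _, [] => 0
  | c, x :: l =>
    if ∀ y ∈ l, x.1 < y.1 then (if c * x.2 = -1 then 1 else 0) + oddAux 1 l else oddAux (c * x.2) l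

/-- No letter of `u` is smaller than all later letters, because `a` follows; so the first
compartment is `u` together with `a`, and the others are those of `v`. -/
theorem oddAux_append_min (a : α) (s : ℤˣ) (v : List (α × ℤˣ)) (hv : ∀ y ∈ v, a < y.1) :
    ∀ (u : List (α × ℤˣ)) (_ : ∀ x ∈ u, a < x.1) (c : ℤˣ),
      oddAux c (u ++ (a, s) :: v) =
        (if c * (wordSign u * s) = -1 then 1 else 0) + oddAux 1 v
  | [], _, c => by
    rw [List.nil_append, oddAux, if_pos hv]
    simp [wordSign]
  | x :: u, hu, c => by
    have hx : ¬ ∀ y ∈ u ++ (a, s) :: v, x.1 < y.1 := by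
      intro h
      exact lt_asymm (h (a, s) (by simp)) (hu x (by simp))
    rw [List.cons_append, oddAux, if_neg hx,
      oddAux_append_min a s v hv u (fun y hy => hu y (by simp [hy]))]
    simp [wordSign, mul_assoc]

/-- A positive letter is larger than the letter right before it. -/
abbrev NormalStep (x y : α × ℤˣ) : Prop := y.2 = 1 → x.1 < y.1

/-- `l` is a normal signed word whose set of letters is `A`, each letter occurring once. -/
structure IsWordOn (A : Finset α) (l : List (α × ℤˣ)) : Prop where
  chain : l.IsChain NormalStep
  nodup : (l.map Prod.fst).Nodup
  mem_iff : ∀ x, x ∈ l.map Prod.fst ↔ x ∈ A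

theorem IsWordOn.eq_nil_iff {A : Finset α} {l : List (α × ℤˣ)} (h : IsWordOn A l) :
    l = [] ↔ A = ∅ := by
  constructor
  · rintro rfl
    ext x
    simpa using (h.mem_iff x).symm
  · rintro rfl
    cases l with
    | nil => rfl
    | cons x l => simpa using h.mem_iff x.1

theorem IsWordOn.fst_mem {A : Finset α} {l : List (α × ℤˣ)} (h : IsWordOn A l) {x : α × ℤˣ}
    (hx : x ∈ l) : x.1 ∈ A :=
  (h.mem_iff _).1 (List.mem_map_of_mem hx)

/-- Only the two junctions matter. A letter right after the minimum may have any sign; the minimum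
itself is smaller than any predecessor, so it can be positive only in first place. -/
theorem normal_append_min_iff (a : α) (s : ℤˣ) (u v : List (α × ℤˣ)) (hu : ∀ x ∈ u, a < x.1)
    (hv : ∀ y ∈ v, a < y.1) :
    (u ++ (a, s) :: v).IsChain NormalStep ↔
      u.IsChain NormalStep ∧ v.IsChain NormalStep ∧ (s = 1 → u = []) := by
  rw [List.isChain_append, List.isChain_cons]
  constructor
  · rintro ⟨h1, ⟨-, h2⟩, h3⟩
    refine ⟨h1, h2, fun hs => ?_⟩
    by_contra hne
    have h4 := h3 (u.getLast hne) (by simp [List.getLast?_eq_some_getLast hne]) (a, s) (by simp) hs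
    exact lt_asymm h4 (hu _ (List.getLast_mem hne))
  · rintro ⟨h1, h2, h3⟩
    refine ⟨h1, ⟨fun y hy _ => hv y (List.mem_of_mem_head? hy), h2⟩, ?_⟩
    intro x hx y hy hy1
    simp only [List.head?_cons, Option.mem_def, Option.some.injEq] at hy
    subst hy
    rw [h3 hy1] at hx
    simp at hx

theorem isWordOn_append_min_iff {A B : Finset α} {a : α} (hA : ∀ x ∈ A, a ≤ x)
    (ha : a ∈ A) (hB : B ⊆ A.erase a) (s : ℤˣ) (u v : List (α × ℤˣ)) (hu : IsWordOn B u)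
    (hv : IsWordOn (A.erase a \ B) v) :
    IsWordOn A (u ++ (a, s) :: v) ↔ (s = 1 → u = []) := by
  have hlt : ∀ x ∈ A.erase a, a < x := fun x hx =>
    lt_of_le_of_ne (hA x (Finset.mem_of_mem_erase hx)) (Finset.ne_of_mem_erase hx).symm
  have hu' : ∀ x ∈ u, a < x.1 := fun x hx => hlt _ (hB (hu.fst_mem hx))
  have hv' : ∀ x ∈ v, a < x.1 := fun x hx => hlt _ (Finset.mem_sdiff.1 (hv.fst_mem hx)).1
  have hc := normal_append_min_iff a s u v hu' hv'
  refine ⟨fun h => (hc.1 h.chain).2.2, fun h => ⟨hc.2 ⟨hu.chain, hv.chain, h⟩, ?_, ?_⟩⟩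
  · rw [List.map_append, List.map_cons, List.nodup_append, List.nodup_cons]
    refine ⟨hu.nodup, ⟨fun h => ?_, hv.nodup⟩, ?_⟩
    · simpa using (Finset.mem_sdiff.1 ((hv.mem_iff _).1 h)).1
    · intro x hx y hy hxy
      have hxB := (hu.mem_iff x).1 hx
      rcases List.mem_cons.1 hy with h | h
      · exact absurd (hB hxB) (by simp [hxy, h])
      · exact (Finset.mem_sdiff.1 ((hv.mem_iff y).1 h)).2 (hxy ▸ hxB)
  · intro x
    rw [List.map_append, List.mem_append, List.map_cons, List.mem_cons, hu.mem_iff, hv.mem_iff,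
      Finset.mem_sdiff, Finset.mem_erase]
    constructor
    · rintro (h | h | h)
      · exact Finset.mem_of_mem_erase (hB h)
      · exact h ▸ ha
      · exact h.1.2
    · intro h
      by_cases h1 : x ∈ B
      · exact Or.inl h1
      · by_cases h2 : x = a
        · exact Or.inr (Or.inl h2)
        · exact Or.inr (Or.inr ⟨⟨h2, h⟩, h1⟩)

theorem IsWordOn.exists_append_min {A : Finset α} {a : α} (hA : ∀ x ∈ A, a ≤ x)
    (ha : a ∈ A) {l : List (α × ℤˣ)} (hl : IsWordOn A l) :
    ∃ B ⊆ A.erase a, ∃ u v s, IsWordOn B u ∧ IsWordOn (A.erase a \ B) v ∧ (s = 1 → u = []) ∧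
      l = u ++ (a, s) :: v := by
  obtain ⟨⟨a', s⟩, hx, rfl⟩ := List.mem_map.1 ((hl.mem_iff a).2 ha)
  obtain ⟨u, v, rfl⟩ := List.append_of_mem hx
  dsimp only at *
  have hnd := hl.nodup
  rw [List.map_append, List.map_cons, List.nodup_append, List.nodup_cons] at hnd
  obtain ⟨hn1, ⟨hn2, hn3⟩, hn4⟩ := hnd
  have hm := hl.mem_iff
  have hau : ∀ x ∈ u.map Prod.fst, x ≠ a' := fun x hx => hn4 x hx a' (by simp)
  have hu' : ∀ x ∈ u, a' < x.1 := fun x hx =>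
    lt_of_le_of_ne (hA _ (hl.fst_mem (by simp [hx]))) (hau _ (List.mem_map_of_mem hx)).symm
  have hv' : ∀ x ∈ v, a' < x.1 := fun x hx =>
    lt_of_le_of_ne (hA _ (hl.fst_mem (by simp [hx])))
      (fun h => hn2 (List.mem_map.2 ⟨x, hx, h.symm⟩))
  obtain ⟨hc1, hc2, hc3⟩ := (normal_append_min_iff a' s u v hu' hv').1 hl.chain
  refine ⟨(u.map Prod.fst).toFinset, ?_, u, v, s, ⟨hc1, hn1, by simp⟩, ⟨hc2, hn3, ?_⟩, hc3, rfl⟩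
  · intro x hx
    rw [List.mem_toFinset] at hx
    exact Finset.mem_erase.2 ⟨hau x hx, (hm x).1 (by rw [List.map_append]; simp only [List.mem_append, hx, true_or])⟩
  · intro x
    rw [Finset.mem_sdiff, Finset.mem_erase, ← hm, List.mem_toFinset, List.map_append,
      List.mem_append, List.map_cons, List.mem_cons]
    constructor
    · intro h
      exact ⟨⟨fun h' => hn2 (h' ▸ h), Or.inr (Or.inr h)⟩,
        fun h' => hn4 x h' x (List.mem_cons_of_mem _ h) rfl⟩
    · rintro ⟨⟨h1, h2 | h2 | h2⟩, h3⟩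
      · exact absurd h2 h3
      · exact absurd h2 h1
      · exact h2

theorem IsWordOn.flipHead {A : Finset α} {l : List (α × ℤˣ)} (h : IsWordOn A l) :
    IsWordOn A (flipHead l) := by
  cases l with
  | nil => exact h
  | cons x l =>
    refine ⟨?_, by simpa [_root_.flipHead] using h.nodup, by simpa [_root_.flipHead] using h.mem_iff⟩
    have := h.chain
    rw [List.isChain_cons] at this
    rw [_root_.flipHead, List.isChain_cons]
    exact this

variable [Fintype α]

theorem finite_isWordOn (A : Finset α) : {l : List (α × ℤˣ) | IsWordOn A l}.Finite := by
  refine (List.finite_length_le (α × ℤˣ) (Fintype.card α)).subset fun l hl => ?_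
  simpa using hl.nodup.length_le_card

/-- The normal signed words with set of letters `A`. -/
noncomputable def words (A : Finset α) : Finset (List (α × ℤˣ)) := (finite_isWordOn A).toFinset

@[simp] theorem mem_words {A : Finset α} {l : List (α × ℤˣ)} : l ∈ words A ↔ IsWordOn A l := by
  simp [words]

theorem words_empty : words (∅ : Finset α) = {[]} := by
  ext l
  rw [mem_words, Finset.mem_singleton]
  refine ⟨fun h => h.eq_nil_iff.2 rfl, ?_⟩
  rintro rfl
  exact ⟨by simp, by simp, by simp⟩

theorem sum_words_eq_sum_split {M : Type*} [AddCommMonoid M] {A : Finset α} {a : α}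
    (hA : ∀ x ∈ A, a ≤ x) (ha : a ∈ A) (g : List (α × ℤˣ) → M) :
    ∑ l ∈ words A, g l = ∑ B ∈ (A.erase a).powerset, ∑ u ∈ words B,
      ∑ v ∈ words (A.erase a \ B), ∑ s : ℤˣ,
        if s = 1 → u = [] then g (u ++ (a, s) :: v) else 0 := by
  classical
  symm
  simp_rw [← Finset.sum_product' (words _) (words _), ← Finset.sum_product' (_ ×ˢ _) Finset.univ,
    Finset.sum_sigma', ← Finset.sum_filter]
  refine Finset.sum_bij (fun x _ => x.2.1.1 ++ (a, x.2.2) :: x.2.1.2) ?_ ?_ ?_ (fun _ _ => rfl)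
  · rintro ⟨B, ⟨u, v⟩, s⟩ hx
    simp only [Finset.mem_filter, Finset.mem_sigma, Finset.mem_powerset, Finset.mem_product,
      mem_words, Finset.mem_univ, and_true] at hx
    obtain ⟨⟨hB, hu, hv⟩, hs⟩ := hx
    exact mem_words.2 ((isWordOn_append_min_iff hA ha hB s u v hu hv).2 hs)
  · rintro ⟨B, ⟨u, v⟩, s⟩ hx ⟨B', ⟨u', v'⟩, s'⟩ hx' h
    simp only [Finset.mem_filter, Finset.mem_sigma, Finset.mem_powerset, Finset.mem_product,
      mem_words, Finset.mem_univ, and_true] at hx hx'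
    obtain ⟨⟨hB, hu, hv⟩, hs⟩ := hx
    obtain ⟨⟨hB', hu', hv'⟩, hs'⟩ := hx'
    obtain ⟨rfl, rfl, rfl⟩ := append_cons_inj_of_fst_ne
      (fun x hx => (Finset.mem_erase.1 (hB (hu.fst_mem hx))).1)
      (fun x hx => (Finset.mem_erase.1 (hB' (hu'.fst_mem hx))).1) h
    have : B = B' := by
      ext x
      rw [← hu.mem_iff, ← hu'.mem_iff]
    rw [this]
  · intro l hl
    obtain ⟨B, hB, u, v, s, hu, hv, hs, rfl⟩ := (mem_words.1 hl).exists_append_min hA ha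
    refine ⟨⟨B, ⟨u, v⟩, s⟩, ?_, rfl⟩
    simp only [Finset.mem_filter, Finset.mem_sigma, Finset.mem_powerset, Finset.mem_product,
      mem_words, Finset.mem_univ, and_true]
    exact ⟨⟨hB, hu, hv⟩, hs⟩

/-- Normality leaves the sign of the first letter free. Flipping it is an involution on nonempty
words that reverses the product of the signs, so both products occur equally often. -/
theorem sum_words_sign {A : Finset α} (hA : A ≠ ∅) (g : ℤˣ → ℚ) :
    ∑ l ∈ words A, g (wordSign l) = (words A).card / 2 * (g 1 + g (-1)) := by
  have h1 : ∑ l ∈ words A, g (wordSign l) = ∑ l ∈ words A, g (-wordSign l) := by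
    refine Finset.sum_nbij' flipHead flipHead ?_ ?_ ?_ ?_ ?_
    · intro l hl
      exact mem_words.2 (mem_words.1 hl).flipHead
    · intro l hl
      exact mem_words.2 (mem_words.1 hl).flipHead
    · intro l _
      exact flipHead_flipHead l
    · intro l _
      exact flipHead_flipHead l
    · intro l hl
      cases l with
      | nil => exact absurd ((mem_words.1 hl).eq_nil_iff.1 rfl) hA
      | cons x l => simp [flipHead, wordSign]
  have h2 : ∑ l ∈ words A, (g (wordSign l) + g (-wordSign l)) =
      ∑ _l ∈ words A, (g 1 + g (-1)) := by
    refine Finset.sum_congr rfl fun l _ => ?_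
    rcases Int.units_eq_one_or (wordSign l) with h | h <;> rw [h]
    rw [neg_neg, add_comm]
  rw [Finset.sum_add_distrib, ← h1, Finset.sum_const, nsmul_eq_mul] at h2
  linarith

/-- The sum of `t ^ (number of odd compartments)` over the normal words on `A`. -/
noncomputable def wordSum (t : ℚ) (A : Finset α) : ℚ := ∑ l ∈ words A, t ^ oddAux 1 l

/-- Half the number of the normal words on `A`, with the convention that it is `1` for `A = ∅`. -/
noncomputable def halfCount (A : Finset α) : ℚ := if A = ∅ then 1 else (words A).card / 2

theorem wordSum_empty (t : ℚ) : wordSum t (∅ : Finset α) = 1 := by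
  simp [wordSum, words_empty, oddAux]

theorem wordSum_one (A : Finset α) : wordSum 1 A = (words A).card := by
  simp [wordSum]

/-- If `B` is empty, the minimum stands alone with either sign. Otherwise it is negative, and
exactly half of the words `u` make the compartment odd. The convention `halfCount ∅ = 1` unites the
two cases. -/
theorem sum_first_compartment (t : ℚ) (B : Finset α) :
    (∑ u ∈ words B, ∑ s : ℤˣ,
      if s = 1 → u = [] then t ^ (if wordSign u * s = -1 then 1 else 0) else 0) =
      (t + 1) * halfCount B := by
  have hne : (-1 : ℤˣ) ≠ 1 := by decide
  have hne' : (1 : ℤˣ) ≠ -1 := by decide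
  by_cases hB : B = ∅
  · subst hB
    simp [words_empty, halfCount, wordSign, hne, hne', add_comm]
  · have : ∀ u ∈ words B, (∑ s : ℤˣ, if s = 1 → u = [] then
        t ^ (if wordSign u * s = -1 then 1 else 0) else 0) =
        (fun c : ℤˣ => t ^ (if -c = -1 then 1 else 0)) (wordSign u) := by
      intro u hu
      have hu' : u ≠ [] := fun h => hB ((mem_words.1 hu).eq_nil_iff.1 h)
      simp [hu', hne]
    rw [Finset.sum_congr rfl this,
      sum_words_sign hB (fun c : ℤˣ => t ^ (if -c = -1 then 1 else 0))]
    simp [halfCount, hB, hne']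
    ring

/-- This is W' = (t+1) F W in combinatorial form: removing the least letter is differentiation, and
distributing the other letters over two words is multiplication of egfs. -/
theorem wordSum_split (t : ℚ) {A : Finset α} {a : α} (hA : ∀ x ∈ A, a ≤ x) (ha : a ∈ A) :
    wordSum t A = (t + 1) * ∑ B ∈ (A.erase a).powerset,
      halfCount B * wordSum t (A.erase a \ B) := by
  rw [wordSum, sum_words_eq_sum_split hA ha, Finset.mul_sum]
  refine Finset.sum_congr rfl fun B hB => ?_
  rw [← mul_assoc, ← sum_first_compartment, wordSum, Finset.sum_mul_sum]
  refine Finset.sum_congr rfl fun u hu => ?_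
  refine Finset.sum_congr rfl fun v hv => ?_
  rw [Finset.sum_mul]
  refine Finset.sum_congr rfl fun s _ => ?_
  rw [ite_mul, zero_mul]
  refine if_congr Iff.rfl ?_ rfl
  have hlt : ∀ x ∈ A.erase a, a < x := fun x hx =>
    lt_of_le_of_ne (hA x (Finset.mem_of_mem_erase hx)) (Finset.ne_of_mem_erase hx).symm
  rw [oddAux_append_min a s v _ u _, one_mul, pow_add]
  · exact fun x hx => hlt _ (Finset.mem_sdiff.1 ((mem_words.1 hv).fst_mem hx)).1
  · exact fun x hx => hlt _ (Finset.mem_powerset.1 hB ((mem_words.1 hu).fst_mem hx))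

end Words

/-! ### The differential equation and its solutions -/

section ExponentialGeneratingFunctions

open PowerSeries Nat

/-- The sequence of which `θ` is the exponential generating function. -/
noncomputable def egfCoeff (θ : PowerSeries ℚ) (n : ℕ) : ℚ := n ! * coeff n θ

theorem egfCoeff_zero (θ : PowerSeries ℚ) : egfCoeff θ 0 = constantCoeff θ := by
  simp [egfCoeff]

theorem egfCoeff_succ (θ : PowerSeries ℚ) (n : ℕ) :
    egfCoeff θ (n + 1) = egfCoeff (derivative ℚ θ) n := by
  rw [egfCoeff, egfCoeff, coeff_derivative, Nat.factorial_succ]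
  push_cast
  ring

theorem egfCoeff_mul {α : Type*} [DecidableEq α] (θ ψ : PowerSeries ℚ) (S : Finset α) :
    egfCoeff (θ * ψ) S.card = ∑ B ∈ S.powerset, egfCoeff θ B.card * egfCoeff ψ (S \ B).card := by
  have h1 : ∑ B ∈ S.powerset, egfCoeff θ B.card * egfCoeff ψ (S \ B).card =
      ∑ B ∈ S.powerset, (fun k => egfCoeff θ k * egfCoeff ψ (S.card - k)) B.card :=
    Finset.sum_congr rfl fun B hB => by
      rw [Finset.card_sdiff_of_subset (Finset.mem_powerset.1 hB)]
  rw [h1,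
    Finset.sum_powerset_apply_card (fun k => egfCoeff θ k * egfCoeff ψ (S.card - k)), egfCoeff, coeff_mul,
    Finset.Nat.sum_antidiagonal_eq_sum_range_succ (fun i j => coeff i θ * coeff j ψ),
    Finset.mul_sum]
  refine Finset.sum_congr rfl fun k hk => ?_
  have hk' : k ≤ S.card := Nat.lt_succ_iff.1 (Finset.mem_range.1 hk)
  rw [nsmul_eq_mul, ← Nat.choose_mul_factorial_mul_factorial hk', egfCoeff, egfCoeff]
  push_cast
  ring

/-- The power series of `1 / (2 - e ^ x)`. -/
noncomputable def fubiniSeries : PowerSeries ℚ := (2 - exp ℚ)⁻¹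

/-- The power series of `2 e ^ (-x) - 1`. -/
noncomputable def blockSeries : PowerSeries ℚ := 2 * evalNegHom (exp ℚ) - 1

theorem fubiniSeries_mul : fubiniSeries * (2 - exp ℚ) = 1 :=
  PowerSeries.inv_mul_cancel _ (by
    rw [map_sub, constantCoeff_exp, map_ofNat]
    norm_num)

theorem derivative_two_mul (θ : PowerSeries ℚ) :
    derivative ℚ (2 * θ - 1) = 2 * derivative ℚ θ := by
  rw [two_mul, two_mul, map_sub, map_add, derivative_one, sub_zero]

/-- F' = F² e^x, and F (2 - e^x) = 1 turns F e^x into 2F - 1. Doubled, this is the equation for t =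
1 with W = 2F - 1. -/
theorem derivative_fubiniSeries :
    derivative ℚ fubiniSeries = fubiniSeries * (2 * fubiniSeries - 1) := by
  have h2 : derivative ℚ (2 - exp ℚ) = -exp ℚ := by
    have : (2 - exp ℚ : PowerSeries ℚ) = 1 + 1 - exp ℚ := by norm_num
    rw [this, map_sub, map_add, derivative_one, derivative_exp]
    ring
  rw [fubiniSeries, derivative_inv', h2, ← fubiniSeries]
  linear_combination (-fubiniSeries) * fubiniSeries_mul

/-- Differentiate e^x e^(-x) = 1 and cancel e^x by multiplying with e^(-x). -/
theorem derivative_evalNegHom_exp :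
    derivative ℚ (evalNegHom (exp ℚ)) = -evalNegHom (exp ℚ) := by
  have h := exp_mul_exp_neg_eq_one (A := ℚ)
  have h1 := congrArg (derivative ℚ) h
  rw [derivative_one, Derivation.leibniz, derivative_exp, smul_eq_mul, smul_eq_mul] at h1
  linear_combination evalNegHom (exp ℚ) * h1 -
    (derivative ℚ (evalNegHom (exp ℚ)) + evalNegHom (exp ℚ)) * h

theorem fubiniSeries_mul_blockSeries : fubiniSeries * blockSeries = evalNegHom (exp ℚ) := by
  rw [blockSeries]
  linear_combination evalNegHom (exp ℚ) * fubiniSeries_mul +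
    fubiniSeries * exp_mul_exp_neg_eq_one (A := ℚ)

/-- This is the equation for t = -(2m+1), where t + 1 = -2m. With G = 2e^(-x) - 1 one has F G =
e^(-x), hence G' = -2 F G. -/
theorem derivative_blockSeries_pow (m : ℕ) : derivative ℚ (blockSeries ^ m) =
    PowerSeries.C (-(2 * m + 1 : ℚ) + 1) * (fubiniSeries * blockSeries ^ m) := by
  have h : derivative ℚ blockSeries = -2 * (fubiniSeries * blockSeries) := by
    rw [fubiniSeries_mul_blockSeries, blockSeries, derivative_two_mul, derivative_evalNegHom_exp]
    ring
  have hC : PowerSeries.C (-(2 * m + 1 : ℚ) + 1) = (-2 * m : PowerSeries ℚ) := by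
    rw [map_add, map_neg, map_add, map_mul, map_one, map_natCast, map_ofNat]
    ring
  rw [hC, Derivation.leibniz_pow, h]
  cases m with
  | zero => simp
  | succ m =>
    simp only [smul_eq_mul, nsmul_eq_mul, Nat.add_sub_cancel]
    push_cast
    ring

theorem constantCoeff_fubiniSeries : constantCoeff fubiniSeries = 1 := by
  have h := congrArg (constantCoeff (R := ℚ)) fubiniSeries_mul
  rw [map_mul, map_sub, constantCoeff_exp, map_ofNat, map_one] at h
  linarith

theorem coeff_evalNegHom_exp (n : ℕ) :
    coeff n (evalNegHom (exp ℚ)) = (-1) ^ n * (1 / n ! : ℚ) := by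
  rw [evalNegHom, coeff_rescale, coeff_exp]
  simp

theorem egfCoeff_blockSeries (n : ℕ) :
    egfCoeff blockSeries n = (-1) ^ n * if n = 0 then 1 else 2 := by
  have h : (n ! : ℚ) ≠ 0 := by exact_mod_cast n.factorial_ne_zero
  rw [egfCoeff, blockSeries, map_sub, two_mul, map_add, coeff_evalNegHom_exp, coeff_one]
  split_ifs with hn
  · subst hn
    norm_num
  · field_simp
    ring

theorem constantCoeff_blockSeries : constantCoeff blockSeries = 1 := by
  rw [← egfCoeff_zero, egfCoeff_blockSeries]
  norm_num

variable {α : Type*} [LinearOrder α] [Fintype α]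

/-- The recursion uses `halfCount` only on sets smaller than `A`; with `hk` restricted to these, the
lemma can serve inside the induction that determines `halfCount`. -/
theorem wordSum_eq_egfCoeff_of_lt {t : ℚ} {ψ : PowerSeries ℚ} (h0 : constantCoeff ψ = 1)
    (h1 : derivative ℚ ψ = PowerSeries.C (t + 1) * (fubiniSeries * ψ)) (k : ℕ)
    (hk : ∀ B : Finset α, B.card < k → halfCount B = egfCoeff fubiniSeries B.card)
    (A : Finset α) (hA : A.card ≤ k) : wordSum t A = egfCoeff ψ A.card := by
  induction hn : A.card using Nat.strong_induction_on generalizing A with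
  | _ n ih =>
    rcases A.eq_empty_or_nonempty with rfl | hne
    · rw [wordSum_empty, ← hn, Finset.card_empty, egfCoeff_zero, h0]
    · set a := A.min' hne with ha
      have haA : a ∈ A := A.min'_mem hne
      have hcard := Finset.card_erase_add_one haA
      rw [wordSum_split t (fun x hx => A.min'_le x hx) haA, ← hn, ← hcard, egfCoeff_succ, h1]
      have h2 : egfCoeff (PowerSeries.C (t + 1) * (fubiniSeries * ψ)) (A.erase a).card =
          (t + 1) * egfCoeff (fubiniSeries * ψ) (A.erase a).card := by
        rw [egfCoeff, egfCoeff, coeff_C_mul]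
        ring
      rw [h2, egfCoeff_mul]
      congr 1
      refine Finset.sum_congr rfl fun B hB => ?_
      have hB' := Finset.card_le_card (Finset.mem_powerset.1 hB)
      have hB'' := Finset.card_le_card (Finset.sdiff_subset (s := A.erase a) (t := B))
      rw [hk B (by omega), ih _ (by omega) _ (by omega) rfl]

theorem halfCount_eq_egfCoeff (A : Finset α) :
    halfCount A = egfCoeff fubiniSeries A.card := by
  induction hn : A.card using Nat.strong_induction_on generalizing A with
  | _ n ih =>
    rcases A.eq_empty_or_nonempty with rfl | hne
    · rw [← hn, Finset.card_empty, egfCoeff_zero, constantCoeff_fubiniSeries, halfCount,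
        if_pos rfl]
    · have h := wordSum_eq_egfCoeff_of_lt (t := 1) (ψ := 2 * fubiniSeries - 1) (by
          rw [map_sub, map_mul, constantCoeff_fubiniSeries, map_ofNat, map_one]
          norm_num) (by
          rw [derivative_two_mul, derivative_fubiniSeries]
          have : (PowerSeries.C (1 + 1 : ℚ)) = (2 : PowerSeries ℚ) := by
            rw [one_add_one_eq_two, map_ofNat]
          rw [this]) n (fun B hB => ih _ hB B rfl) A hn.le
      -- At t = 1 the sum counts all normal words. The -1 in 2F - 1 affects only degree 0, so
      -- halving gives F.
      rw [halfCount, if_neg hne.ne_empty, ← wordSum_one, h, ← hn, egfCoeff, egfCoeff, map_sub,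
        two_mul, map_add, coeff_one, if_neg (Finset.card_pos.2 hne).ne']
      ring

theorem wordSum_eq_egfCoeff (m : ℕ) (A : Finset α) :
    wordSum (-(2 * m + 1)) A = egfCoeff (blockSeries ^ m) A.card :=
  wordSum_eq_egfCoeff_of_lt (by rw [map_pow, constantCoeff_blockSeries, one_pow])
    (derivative_blockSeries_pow m) A.card (fun B _ => halfCount_eq_egfCoeff B) A le_rfl

end ExponentialGeneratingFunctions

/-! ### Signed permutations as words -/

namespace SignedPerm

variable {n : ℕ}

/-- The word of a signed permutation. -/
def toWord (p : SignedPerm n) : List (Fin n × ℤˣ) := List.ofFn fun i => (p.1 i, p.2 i)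

theorem toWord_injective : Function.Injective (toWord (n := n)) := by
  intro p q h
  have h1 := List.ofFn_injective h
  refine Prod.ext (Equiv.ext fun i => ?_) (funext fun i => ?_)
  · exact congrArg Prod.fst (congrFun h1 i)
  · exact congrArg Prod.snd (congrFun h1 i)

theorem isNormal_iff_isChain (p : SignedPerm n) :
    p.IsNormal ↔ p.toWord.IsChain NormalStep := by
  rw [List.isChain_iff_getElem]
  constructor
  · intro h i hi
    simp only [toWord, List.length_ofFn] at hi
    simpa [toWord] using h ⟨i, by omega⟩ ⟨i + 1, hi⟩ rfl
  · rintro h ⟨i, hi⟩ ⟨j, hj⟩ hij hs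
    obtain rfl : i + 1 = j := hij
    have h1 := h i (by simpa only [toWord, List.length_ofFn] using hj)
    simpa [toWord] using h1 (by simpa [toWord] using hs)

theorem isWordOn_toWord_iff (p : SignedPerm n) :
    IsWordOn Finset.univ p.toWord ↔ p.IsNormal := by
  refine ⟨fun h => (isNormal_iff_isChain p).2 h.chain,
    fun h => ⟨(isNormal_iff_isChain p).1 h, ?_, fun x => ?_⟩⟩
  · rw [toWord, List.map_ofFn, List.nodup_ofFn]
    exact p.1.injective
  · rw [toWord, List.map_ofFn, List.mem_ofFn]
    simpa using p.1.surjective x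

theorem exists_toWord_eq {l : List (Fin n × ℤˣ)} (h : IsWordOn Finset.univ l) :
    ∃ p : SignedPerm n, p.toWord = l := by
  have hlen : l.length = n := by
    have h1 : (l.map Prod.fst).toFinset = Finset.univ := by
      ext x
      simpa using h.mem_iff x
    have h2 := List.toFinset_card_of_nodup h.nodup
    rw [h1, Finset.card_univ, Fintype.card_fin, List.length_map] at h2
    exact h2.symm
  have hinj : Function.Injective fun i : Fin n => (l.get (i.cast hlen.symm)).1 := by
    intro i j hij
    have h1 := h.nodup.get_inj_iff (i := ⟨i, by simp [hlen]⟩) (j := ⟨j, by simp [hlen]⟩)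
    simp only [List.get_eq_getElem, List.getElem_map, Fin.mk.injEq] at h1
    exact Fin.ext (h1.1 hij)
  refine ⟨(Equiv.ofBijective _ (Finite.injective_iff_bijective.1 hinj),
    fun i => (l.get (i.cast hlen.symm)).2), ?_⟩
  refine List.ext_getElem (by simp [toWord, hlen]) fun i h1 h2 => ?_
  simp [toWord]

/-- The lines drawn from a given line on. -/
inductive LineFrom (p : SignedPerm n) (c : ℕ) : ℕ → Prop
  | start : LineFrom p c c
  | next (a : ℕ) (i : Fin n) : LineFrom p c a → p.IsLeastFrom a i → LineFrom p c (i.val + 1)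

theorem isLine_iff_lineFrom (p : SignedPerm n) (a : ℕ) : p.IsLine a ↔ p.LineFrom 0 a := by
  constructor
  · intro h
    induction h with
    | start => exact .start
    | next a i _ hi ih => exact .next a i ih hi
  · intro h
    induction h with
    | start => exact .start
    | next a i _ hi ih => exact .next a i ih hi

theorem LineFrom.le {p : SignedPerm n} {c a : ℕ} (h : p.LineFrom c a) : c ≤ a := by
  induction h with
  | start => exact le_rfl
  | next a i _ hi ih => exact (ih.trans hi.1).trans (Nat.le_succ _)

theorem IsLeastFrom.unique {p : SignedPerm n} {a : ℕ} {i j : Fin n} (hi : p.IsLeastFrom a i)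
    (hj : p.IsLeastFrom a j) : i = j :=
  p.1.injective (le_antisymm (hi.2 j hj.1) (hj.2 i hi.1))

/-- Each line determines the next one. Allowing an arbitrary starting line lets compartments be
peeled off from the front, as `oddAux` does. -/
theorem lineFrom_iff {p : SignedPerm n} {c : ℕ} {i : Fin n} (hi : p.IsLeastFrom c i) (a : ℕ) :
    p.LineFrom c a ↔ a = c ∨ p.LineFrom (i.val + 1) a := by
  constructor
  · intro h
    induction h with
    | start => exact Or.inl rfl
    | next a k _ hk ih =>
      rcases ih with rfl | h
      · rw [hk.unique hi]
        exact Or.inr .start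
      · exact Or.inr (.next a k h hk)
  · rintro (rfl | h)
    · exact .start
    · induction h with
      | start => exact .next c i .start hi
      | next a k _ hk ih => exact .next a k ih hk

theorem exists_isLeastFrom (p : SignedPerm n) {a : ℕ} (ha : a < n) : ∃ i, p.IsLeastFrom a i := by
  obtain ⟨i, hi, h⟩ := Finset.exists_min_image (Finset.univ.filter fun k : Fin n => a ≤ k.val) p.1
    ⟨⟨a, ha⟩, by simp⟩
  exact ⟨i, by simpa using hi, fun k hk => h k (by simpa using hk)⟩

/-- The odd compartments from a given line on. -/
def oddCompartmentsFrom (p : SignedPerm n) (c : ℕ) : Set (Finset (Fin n)) :=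
  {S | (∃ (a : ℕ) (i : Fin n), p.LineFrom c a ∧ p.IsLeastFrom a i ∧
    S = Finset.univ.filter fun k : Fin n => a ≤ k.val ∧ k ≤ i) ∧
      Odd (S.filter fun k => p.2 k = -1).card}

theorem oddCycles_eq_ncard (p : SignedPerm n) :
    p.oddCycles = (p.oddCompartmentsFrom 0).ncard := by
  simp only [oddCycles, IsCompartment, oddCompartmentsFrom, isLine_iff_lineFrom]

theorem mem_drop_toWord {p : SignedPerm n} {k : ℕ} {x : Fin n × ℤˣ} :
    x ∈ p.toWord.drop k ↔ ∃ i : Fin n, k ≤ i.val ∧ x = (p.1 i, p.2 i) := by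
  rw [List.mem_drop_iff_getElem]
  constructor
  · rintro ⟨i, hi, rfl⟩
    simp only [toWord, List.length_ofFn] at hi
    exact ⟨⟨k + i, by omega⟩, Nat.le_add_right _ _, by simp [toWord]⟩
  · rintro ⟨i, hi, rfl⟩
    refine ⟨i - k, ?_, ?_⟩
    · simp only [toWord, List.length_ofFn]
      omega
    · simp only [toWord, List.getElem_ofFn]
      have : (⟨k + (i.val - k), by omega⟩ : Fin n) = i := Fin.ext (by simp; omega)
      rw [this]

theorem drop_toWord (p : SignedPerm n) (i : Fin n) :
    p.toWord.drop i = (p.1 i, p.2 i) :: p.toWord.drop (i + 1) := by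
  rw [List.drop_eq_getElem_cons (by simp [toWord])]
  simp [toWord]

theorem prod_sign_succ (p : SignedPerm n) {a : ℕ} {k : Fin n} (h : a ≤ k.val) :
    ∏ j ∈ Finset.univ.filter (fun j : Fin n => a ≤ j.val ∧ j.val < k.val + 1), p.2 j =
      (∏ j ∈ Finset.univ.filter (fun j : Fin n => a ≤ j.val ∧ j.val < k.val), p.2 j) * p.2 k := by
  have : Finset.univ.filter (fun j : Fin n => a ≤ j.val ∧ j.val < k.val + 1) =
      insert k (Finset.univ.filter (fun j : Fin n => a ≤ j.val ∧ j.val < k.val)) := by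
    ext j
    simp only [Finset.mem_filter, Finset.mem_univ, true_and, Finset.mem_insert, Fin.ext_iff]
    omega
  rw [this, Finset.prod_insert (by simp), mul_comm]

theorem oddAux_drop_of_le {p : SignedPerm n} {a : ℕ} {i : Fin n} (hi : p.IsLeastFrom a i) (k : ℕ)
    (hak : a ≤ k) (hk : k ≤ i.val) :
    oddAux 1 (p.toWord.drop a) =
      oddAux (∏ j ∈ Finset.univ.filter (fun j : Fin n => a ≤ j.val ∧ j.val < k), p.2 j)
        (p.toWord.drop k) := by
  induction k, hak using Nat.le_induction with
  | base =>
    rw [Finset.filter_false_of_mem (fun j _ => by omega), Finset.prod_empty]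
  | succ k hak ih =>
    have hkn : k < n := by omega
    rw [ih (by omega), drop_toWord p ⟨k, hkn⟩, oddAux, if_neg,
      prod_sign_succ p (k := ⟨k, hkn⟩) hak]
    intro h
    exact absurd (hi.2 ⟨k, hkn⟩ hak)
      (not_le.2 (h (p.1 i, p.2 i) (mem_drop_toWord.2 ⟨i, hk, rfl⟩)))

theorem prod_sign_eq_neg_one_iff (p : SignedPerm n) (S : Finset (Fin n)) :
    ∏ j ∈ S, p.2 j = -1 ↔ Odd (S.filter fun k => p.2 k = -1).card := by
  have h : ∏ j ∈ S, p.2 j = ∏ j ∈ S, if p.2 j = -1 then (-1 : ℤˣ) else 1 := by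
    refine Finset.prod_congr rfl fun j _ => ?_
    rcases Int.units_eq_one_or (p.2 j) with h | h <;> simp [h]
  rw [h, Finset.prod_ite, Finset.prod_const, Finset.prod_const_one, mul_one,
    neg_one_pow_eq_neg_one_iff_odd (by decide)]

theorem oddAux_drop {p : SignedPerm n} {a : ℕ} {i : Fin n} (hi : p.IsLeastFrom a i) :
    oddAux 1 (p.toWord.drop a) =
      (if Odd ((Finset.univ.filter fun k : Fin n => a ≤ k.val ∧ k ≤ i).filter
        fun k => p.2 k = -1).card then 1 else 0) + oddAux 1 (p.toWord.drop (i + 1)) := by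
  rw [oddAux_drop_of_le hi i hi.1 le_rfl, drop_toWord, oddAux, if_pos]
  · congr 1
    refine if_congr ?_ rfl rfl
    rw [← prod_sign_succ p hi.1, ← prod_sign_eq_neg_one_iff]
    simp only [Nat.lt_succ_iff, Fin.le_def]
  · intro y hy
    obtain ⟨j, hj, rfl⟩ := mem_drop_toWord.1 hy
    have hij := hi.1
    refine lt_of_le_of_ne (hi.2 j (by omega)) fun h => ?_
    have := p.1.injective h
    subst this
    omega

theorem ncard_oddCompartmentsFrom (p : SignedPerm n) (a : ℕ) :
    (p.oddCompartmentsFrom a).ncard = oddAux 1 (p.toWord.drop a) := by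
  induction hk : n - a using Nat.strong_induction_on generalizing a with
  | _ k ih =>
    rcases le_or_gt n a with hna | han
    · have h1 : p.oddCompartmentsFrom a = ∅ := by
        refine Set.eq_empty_of_forall_notMem ?_
        rintro S ⟨⟨b, i, hb, hi, -⟩, -⟩
        have := hb.le
        have := hi.1
        omega
      rw [h1, Set.ncard_empty, List.drop_eq_nil_of_le (by simpa [toWord] using hna), oddAux]
    · obtain ⟨i, hi⟩ := p.exists_isLeastFrom han
      have hai := hi.1
      rw [oddAux_drop hi, ← ih (n - (i + 1)) (by omega) (i + 1) rfl]
      set S := Finset.univ.filter fun k : Fin n => a ≤ k.val ∧ k ≤ i with hS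
      have hmem : ∀ T, T ∈ p.oddCompartmentsFrom a ↔
          (T = S ∧ Odd (S.filter fun k => p.2 k = -1).card) ∨
            T ∈ p.oddCompartmentsFrom (i + 1) := by
        intro T
        constructor
        · rintro ⟨⟨b, j, hb, hj, rfl⟩, hodd⟩
          rcases (lineFrom_iff hi b).1 hb with rfl | hb'
          · rw [hj.unique hi] at hodd ⊢
            exact Or.inl ⟨rfl, hodd⟩
          · exact Or.inr ⟨⟨b, j, hb', hj, rfl⟩, hodd⟩
        · rintro (⟨rfl, hodd⟩ | ⟨⟨b, j, hb, hj, rfl⟩, hodd⟩)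
          · exact ⟨⟨a, i, .start, hi, rfl⟩, hodd⟩
          · exact ⟨⟨b, j, (lineFrom_iff hi b).2 (Or.inr hb), hj, rfl⟩, hodd⟩
      -- The peeled compartment contains position `i`, whereas later ones start at `i + 1` or
      -- beyond.
      have hnot : S ∉ p.oddCompartmentsFrom (i + 1) := by
        rintro ⟨⟨b, j, hb, hj, hSb⟩, -⟩
        have h1 : i ∈ S := by simp [hS, hai]
        rw [hSb] at h1
        have h2 := hb.le
        have h3 := (Finset.mem_filter.1 h1).2.1
        omega
      split_ifs with hodd
      · have : p.oddCompartmentsFrom a = insert S (p.oddCompartmentsFrom (i + 1)) := by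
          ext T
          simp [hmem T, hodd]
        rw [this, Set.ncard_insert_of_notMem hnot (Set.toFinite _), add_comm]
      · have : p.oddCompartmentsFrom a = p.oddCompartmentsFrom (i + 1) := by
          ext T
          simp [hmem T, hodd]
        rw [this, zero_add]

theorem oddCycles_eq_oddAux (p : SignedPerm n) : p.oddCycles = oddAux 1 p.toWord := by
  rw [oddCycles_eq_ncard, ncard_oddCompartmentsFrom, List.drop_zero]

end SignedPerm

/-! ### Threshold words -/

/-- The conditions on a normal signed word, all of whose letters are distinct, to be a threshold
word. -/
def IsThresholdWord {α : Type*} [LinearOrder α] : List (α × ℤˣ) → Prop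
  | [] => True
  | x :: l => ((∀ y ∈ l, x.1 < y.1) → x.2 = -1) ∧
      ∀ y ∈ l.head?, x.1 < y.1 ∧ ((¬ ∀ y ∈ l, x.1 < y.1) → y.2 = -1)

namespace SignedPerm

theorem isThreshold_iff {n : ℕ} (p : SignedPerm n) :
    p.IsThreshold ↔ p.IsNormal ∧ IsThresholdWord p.toWord := by
  obtain _ | n := n
  · refine ⟨fun h => ⟨h.lt_of_pos, by simp [toWord, IsThresholdWord]⟩, fun h => ⟨?_, ?_, ?_, h.1⟩⟩
    all_goals exact fun i => i.elim0
  have hdrop : p.toWord = (p.1 0, p.2 0) :: p.toWord.drop 1 := by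
    simpa using drop_toWord p 0
  -- Being smaller than all later letters replaces being the number 1, so that the condition makes
  -- sense for any set of letters.
  have hmin : (∀ y ∈ p.toWord.drop 1, p.1 0 < y.1) ↔ (p.1 0).val = 0 := by
    constructor
    · intro h
      obtain ⟨k, hk⟩ := p.1.surjective 0
      by_cases hk0 : k = 0
      · rw [← hk0, hk]
        rfl
      · have h1 := h (p.1 k, p.2 k) (mem_drop_toWord.2 ⟨k, by
          have : k.val ≠ 0 := fun h => hk0 (Fin.ext h)
          omega, rfl⟩)
        rw [hk] at h1
        exact absurd h1 (Fin.not_lt_zero _)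
    · intro h y hy
      obtain ⟨j, hj, rfl⟩ := mem_drop_toWord.1 hy
      refine Fin.lt_def.2 ?_
      rw [h]
      refine Nat.pos_of_ne_zero fun hj0 => ?_
      have : p.1 j = p.1 0 := Fin.ext (hj0.trans h.symm)
      rw [p.1.injective this] at hj
      simp at hj
  have hhead : ∀ y : Fin (n + 1) × ℤˣ, y ∈ (p.toWord.drop 1).head? ↔
      ∃ j : Fin (n + 1), j.val = 1 ∧ y = (p.1 j, p.2 j) := by
    intro y
    rw [List.head?_drop, Option.mem_def, List.getElem?_eq_some_iff]
    constructor
    · rintro ⟨h, rfl⟩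
      simp only [toWord, List.length_ofFn] at h
      exact ⟨⟨1, h⟩, rfl, by simp [toWord]⟩
    · rintro ⟨⟨j, hj⟩, rfl, rfl⟩
      exact ⟨by simpa [toWord] using hj, by simp [toWord]⟩
  rw [hdrop, IsThresholdWord, hmin]
  constructor
  · intro h
    refine ⟨h.lt_of_pos, h.sign_first 0 rfl, fun y hy => ?_⟩
    obtain ⟨j, hj, rfl⟩ := (hhead y).1 hy
    exact ⟨h.first_lt_second 0 j rfl hj, h.sign_second 0 j rfl hj⟩
  · rintro ⟨h1, h2, h3⟩
    refine ⟨?_, ?_, ?_, h1⟩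
    · intro i j hi hj
      obtain rfl : i = 0 := Fin.ext hi
      exact (h3 _ ((hhead _).2 ⟨j, hj, rfl⟩)).1
    · intro i hi
      obtain rfl : i = 0 := Fin.ext hi
      exact h2
    · intro i j hi hj
      obtain rfl : i = 0 := Fin.ext hi
      exact (h3 _ ((hhead _).2 ⟨j, hj, rfl⟩)).2

end SignedPerm

open Classical in
theorem thresholdCount_eq_card (n j : ℕ) : thresholdCount n j =
    ((words (Finset.univ : Finset (Fin n))).filter
      fun l => IsThresholdWord l ∧ oddAux 1 l = j).card := by
  rw [thresholdCount, ← Set.ncard_image_of_injective _ SignedPerm.toWord_injective,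
    ← Set.ncard_coe_finset]
  congr 1
  ext l
  simp only [Set.mem_image, Set.mem_ofPred_eq, Finset.coe_filter, mem_words]
  constructor
  · rintro ⟨p, ⟨hp, hj⟩, rfl⟩
    obtain ⟨h1, h2⟩ := p.isThreshold_iff.1 hp
    exact ⟨p.isWordOn_toWord_iff.2 h1, h2, by rw [← p.oddCycles_eq_oddAux, hj]⟩
  · rintro ⟨h1, h2, h3⟩
    obtain ⟨p, rfl⟩ := SignedPerm.exists_toWord_eq h1
    exact ⟨p, ⟨p.isThreshold_iff.2 ⟨p.isWordOn_toWord_iff.1 h1, h2⟩,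
      by rw [p.oddCycles_eq_oddAux, h3]⟩, rfl⟩

theorem normalCount_eq_card (n j : ℕ) : normalCount n j =
    ((words (Finset.univ : Finset (Fin n))).filter fun l => oddAux 1 l = j).card := by
  rw [normalCount, ← Set.ncard_image_of_injective _ SignedPerm.toWord_injective,
    ← Set.ncard_coe_finset]
  congr 1
  ext l
  simp only [Set.mem_image, Set.mem_ofPred_eq, Finset.coe_filter, mem_words]
  constructor
  · rintro ⟨p, ⟨hp, hj⟩, rfl⟩
    exact ⟨p.isWordOn_toWord_iff.2 hp, by rw [← p.oddCycles_eq_oddAux, hj]⟩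
  · rintro ⟨h1, h3⟩
    obtain ⟨p, rfl⟩ := SignedPerm.exists_toWord_eq h1
    exact ⟨p, ⟨p.isWordOn_toWord_iff.1 h1, by rw [p.oddCycles_eq_oddAux, h3]⟩, rfl⟩

/-! ### Normal words that are not threshold words -/

section NonThreshold

variable {α : Type*} [LinearOrder α]

theorem isChain_cons_sign (b : α) (s s' : ℤˣ) (l : List (α × ℤˣ)) :
    ((b, s) :: l).IsChain NormalStep ↔ ((b, s') :: l).IsChain NormalStep := by
  rw [List.isChain_cons, List.isChain_cons]

theorem oddAux_cons_sign (b : α) {c d c' d' : ℤˣ} (h : c * d = c' * d') (l : List (α × ℤˣ)) :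
    oddAux c ((b, d) :: l) = oddAux c' ((b, d') :: l) := by
  rw [oddAux, oddAux, h]

/-- Prepend a letter to a normal word such that the result is normal but not a threshold word. -/
def insertFirst (a : α) : List (α × ℤˣ) → List (α × ℤˣ)
  | [] => [(a, 1)]
  | y :: l =>
    if ∀ z ∈ y :: l, a < z.1 then (a, 1) :: y :: l
    else if y.1 < a then (a, -y.2) :: (y.1, -1) :: l else (a, y.2) :: (y.1, 1) :: l

/-- The inverse of `insertFirst`. -/
def removeFirst : List (α × ℤˣ) → List (α × ℤˣ)
  | x :: y :: l => if ∀ z ∈ y :: l, x.1 < z.1 then y :: l else (y.1, x.2 * y.2) :: l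
  | _ => []

theorem map_fst_insertFirst (a : α) (l : List (α × ℤˣ)) :
    (insertFirst a l).map Prod.fst = a :: l.map Prod.fst := by
  cases l with
  | nil => rfl
  | cons y l =>
    rw [insertFirst]
    split_ifs <;> simp

theorem map_fst_removeFirst (x : α × ℤˣ) (l : List (α × ℤˣ)) :
    (removeFirst (x :: l)).map Prod.fst = l.map Prod.fst := by
  cases l with
  | nil => rfl
  | cons y l =>
    rw [removeFirst]
    split_ifs <;> simp

theorem forall_mem_cons_sign (a b : α) (s s' : ℤˣ) (l : List (α × ℤˣ)) :
    (∀ z ∈ (b, s) :: l, a < z.1) ↔ ∀ z ∈ (b, s') :: l, a < z.1 := by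
  rw [List.forall_mem_cons, List.forall_mem_cons]

/-- Unless `a` is least, the two leading signs multiply to the old sign of the second letter,
whichever of the two letters is larger. -/
theorem removeFirst_insertFirst (a : α) (l : List (α × ℤˣ)) :
    removeFirst (insertFirst a l) = l := by
  obtain _ | ⟨⟨b, s⟩, l⟩ := l
  · rfl
  · rw [insertFirst]
    split_ifs with h1 h2
    · rw [removeFirst, if_pos h1]
    · rw [removeFirst, if_neg ((forall_mem_cons_sign a b _ _ l).not.1 h1)]
      simp
    · rw [removeFirst, if_neg ((forall_mem_cons_sign a b _ _ l).not.1 h1)]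
      simp

/-- A new least letter is a positive, hence even, compartment by itself. Any other new letter joins
the first compartment without changing its product of signs. -/
theorem oddAux_insertFirst (a : α) (l : List (α × ℤˣ)) :
    oddAux 1 (insertFirst a l) = oddAux 1 l := by
  have hne : (1 : ℤˣ) ≠ -1 := by decide
  obtain _ | ⟨⟨b, s⟩, l⟩ := l
  · simp [insertFirst, oddAux, hne]
  · rw [insertFirst]
    split_ifs with h1 h2
    · rw [oddAux, if_pos h1, one_mul, if_neg hne, zero_add]
    · rw [oddAux, if_neg ((forall_mem_cons_sign a b _ _ l).not.1 h1)]
      exact oddAux_cons_sign b (by simp) l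
    · rw [oddAux, if_neg ((forall_mem_cons_sign a b _ _ l).not.1 h1)]
      exact oddAux_cons_sign b (by simp) l

theorem isChain_insertFirst {a : α} {l : List (α × ℤˣ)} (hl : l.IsChain NormalStep)
    (ha : a ∉ l.map Prod.fst) : (insertFirst a l).IsChain NormalStep := by
  have hne : (-1 : ℤˣ) ≠ 1 := by decide
  obtain _ | ⟨⟨b, s⟩, l⟩ := l
  · exact List.IsChain.singleton _
  · rw [insertFirst]
    split_ifs with h1 h2
    · exact List.isChain_cons_cons.2 ⟨fun _ => h1 _ (by simp), hl⟩
    · exact List.isChain_cons_cons.2 ⟨fun h => absurd h hne, (isChain_cons_sign b _ _ l).1 hl⟩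
    · refine List.isChain_cons_cons.2 ⟨fun _ => ?_, (isChain_cons_sign b _ _ l).1 hl⟩
      exact lt_of_le_of_ne (not_lt.1 h2) fun h => ha (List.mem_cons.2 (Or.inl h))

theorem not_isThresholdWord_insertFirst (a : α) (l : List (α × ℤˣ)) :
    ¬ IsThresholdWord (insertFirst a l) := by
  have hne : (1 : ℤˣ) ≠ -1 := by decide
  obtain _ | ⟨⟨b, s⟩, l⟩ := l
  · simp [insertFirst, IsThresholdWord, hne]
  · rw [insertFirst]
    split_ifs with h1 h2 <;> rw [IsThresholdWord]
    · exact fun h => hne (h.1 h1)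
    · exact fun h => lt_asymm h2 (h.2 (b, -1) (by simp)).1
    · exact fun h => hne ((h.2 (b, 1) (by simp)).2 ((forall_mem_cons_sign a b _ _ l).not.1 h1))

/-- When the first letter is not least, normality makes the second letter negative at a descent, and
failure of the threshold conditions makes it positive at an ascent. So the product of the two signs
determines both. -/
theorem insertFirst_removeFirst {x : α × ℤˣ} {l : List (α × ℤˣ)}
    (hl : (x :: l).IsChain NormalStep) (hx : x.1 ∉ l.map Prod.fst)
    (ht : ¬ IsThresholdWord (x :: l)) : insertFirst x.1 (removeFirst (x :: l)) = x :: l := by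
  obtain ⟨a, s⟩ := x
  have hs' : ∀ s : ℤˣ, s ≠ -1 → s = 1 := fun s h => (Int.units_eq_one_or s).resolve_right h
  obtain _ | ⟨⟨b, s'⟩, l⟩ := l
  · have : s = 1 := hs' s fun h => ht (by simp [IsThresholdWord, h])
    simp [removeFirst, insertFirst, this]
  · rw [removeFirst]
    rw [List.isChain_cons_cons] at hl
    rw [IsThresholdWord] at ht
    by_cases h1 : ∀ z ∈ (b, s') :: l, a < z.1
    · have h2 : a < b := h1 (b, s') (by simp)
      have : s = 1 := hs' s fun h => ht ⟨fun _ => h, by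
        intro y hy
        obtain rfl : (b, s') = y := by simpa using hy
        exact ⟨h2, fun h => absurd h1 h⟩⟩
      rw [if_pos h1, insertFirst, if_pos h1, this]
    · rw [if_neg h1, insertFirst, if_neg ((forall_mem_cons_sign a b _ _ l).not.1 h1)]
      dsimp only
      split_ifs with h2
      · have : s' = -1 := by
          by_contra h
          exact lt_asymm h2 (hl.1 (hs' s' h))
        simp [this]
      · have h3 : a < b := lt_of_le_of_ne (not_lt.1 h2) fun h => hx (by simp [h])
        have : s' = 1 := hs' s' fun h => ht ⟨fun h' => absurd h' h1, by
          intro y hy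
          obtain rfl : (b, s') = y := by simpa using hy
          exact ⟨h3, fun _ => h⟩⟩
        simp [this]

variable [Fintype α]

open Classical in
theorem sum_not_isThresholdWord {M : Type*} [AddCommMonoid M] (A : Finset α) (g : ℕ → M) :
    ∑ l ∈ words A with ¬ IsThresholdWord l, g (oddAux 1 l) =
      ∑ a ∈ A, ∑ l ∈ words (A.erase a), g (oddAux 1 l) := by
  rw [Finset.sum_sigma']
  symm
  refine Finset.sum_bij (fun x _ => insertFirst x.1 x.2) ?_ ?_ ?_ ?_
  · rintro ⟨a, l⟩ hx
    obtain ⟨ha, hl⟩ := Finset.mem_sigma.1 hx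
    have hl' := mem_words.1 hl
    have hal : a ∉ l.map Prod.fst := fun h => by simpa using (hl'.mem_iff a).1 h
    refine Finset.mem_filter.2 ⟨mem_words.2 ⟨isChain_insertFirst hl'.chain hal, ?_, fun x => ?_⟩,
      not_isThresholdWord_insertFirst a l⟩
    · rw [map_fst_insertFirst, List.nodup_cons]
      exact ⟨hal, hl'.nodup⟩
    · rw [map_fst_insertFirst, List.mem_cons, hl'.mem_iff, Finset.mem_erase]
      constructor
      · rintro (rfl | h)
        · exact ha
        · exact h.2
      · intro h
        by_cases hxa : x = a
        · exact Or.inl hxa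
        · exact Or.inr ⟨hxa, h⟩
  · rintro ⟨a, l⟩ - ⟨a', l'⟩ - h
    have h1 := congrArg (List.map Prod.fst) h
    rw [map_fst_insertFirst, map_fst_insertFirst, List.cons.injEq] at h1
    obtain ⟨rfl, -⟩ := h1
    have h2 := congrArg removeFirst h
    rw [removeFirst_insertFirst, removeFirst_insertFirst] at h2
    dsimp only at h2
    rw [h2]
  · intro l hl
    obtain ⟨hl, ht⟩ := Finset.mem_filter.1 hl
    have hl' := mem_words.1 hl
    obtain _ | ⟨x, l⟩ := l
    · exact absurd (by simp [IsThresholdWord]) ht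
    · have hnd := hl'.nodup
      rw [List.map_cons, List.nodup_cons] at hnd
      have hm := hl'.mem_iff
      refine ⟨⟨x.1, removeFirst (x :: l)⟩, Finset.mem_sigma.2 ⟨hl'.fst_mem (by simp),
        mem_words.2 ⟨?_, ?_, fun z => ?_⟩⟩, insertFirst_removeFirst hl'.chain hnd.1 ht⟩
      · obtain _ | ⟨y, l⟩ := l
        · exact List.IsChain.nil
        · have h1 := (List.isChain_cons_cons.1 hl'.chain).2
          rw [removeFirst]
          split_ifs
          · exact h1
          · exact (isChain_cons_sign y.1 _ _ l).1 h1
      · rw [map_fst_removeFirst]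
        exact hnd.2
      · rw [map_fst_removeFirst, Finset.mem_erase, ← hm, List.map_cons, List.mem_cons]
        constructor
        · exact fun h => ⟨fun h' => hnd.1 (by rw [← show z = x.1 from h']; exact h), Or.inr h⟩
        · exact fun h => h.2.resolve_left h.1
  · rintro ⟨a, l⟩ -
    exact congrArg g (oddAux_insertFirst a l).symm

end NonThreshold

/-! ### Counting box points off the hyperplanes -/

section BoxCount

variable {ι : Type*} [Fintype ι] [DecidableEq ι]

/-- The integer points all of whose coordinates have absolute value at most `m`. -/
noncomputable def intBox (ι : Type*) [Fintype ι] [DecidableEq ι] (m : ℕ) : Finset (ι → ℤ) :=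
  Fintype.piFinset fun _ => Finset.Icc (-(m : ℤ)) m

theorem mem_intBox {m : ℕ} {x : ι → ℤ} : x ∈ intBox ι m ↔ ∀ i, |x i| ≤ m := by
  simp [intBox, abs_le]

/-- The points of the box that vanish outside `A` and have no two opposite (or zero) coordinates in
`A`. -/
noncomputable def sepSet (A : Finset ι) (m : ℕ) : Finset (ι → ℤ) :=
  {x ∈ intBox ι m | (∀ i, i ∉ A → x i = 0) ∧ ∀ i ∈ A, ∀ j ∈ A, x i + x j ≠ 0}

theorem mem_sepSet {A : Finset ι} {m : ℕ} {x : ι → ℤ} : x ∈ sepSet A m ↔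
    (∀ i, |x i| ≤ m) ∧ (∀ i, i ∉ A → x i = 0) ∧ ∀ i ∈ A, ∀ j ∈ A, x i + x j ≠ 0 := by
  rw [sepSet, Finset.mem_filter, mem_intBox]

theorem card_sepSet_zero (A : Finset ι) :
    (sepSet A 0).card = if A = ∅ then 1 else 0 := by
  split_ifs with hA
  · subst hA
    refine Finset.card_eq_one.2 ⟨0, ?_⟩
    ext x
    rw [mem_sepSet, Finset.mem_singleton]
    constructor
    · exact fun h => funext fun i => h.2.1 i (Finset.notMem_empty i)
    · rintro rfl
      simp
  · obtain ⟨i, hi⟩ := Finset.nonempty_iff_ne_empty.2 hA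
    refine Finset.card_eq_zero.2 (Finset.eq_empty_of_forall_notMem fun x hx => ?_)
    rw [mem_sepSet] at hx
    have h1 := abs_nonpos_iff.1 (hx.1 i)
    exact hx.2.2 i hi i hi (by simp [h1])

/-- Let `B` be the set of coordinates of absolute value m + 1. They share one sign, since opposite
values are excluded; the rest is a point for `A \ B` in the smaller box. -/
theorem card_sepSet_succ (A : Finset ι) (m : ℕ) : (sepSet A (m + 1)).card =
    ∑ B ∈ A.powerset, (if B = ∅ then 1 else 2) * (sepSet (A \ B) m).card := by
  -- For empty `B` the common sign is meaningless; fixing it to be 1 keeps the parametrization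
  -- injective.
  have hcard : ∀ B : Finset ι, (if B = ∅ then 1 else 2) =
      (if B = ∅ then {1} else {1, -1} : Finset ℤ).card := by
    intro B
    split_ifs <;> rfl
  simp_rw [hcard, ← Finset.card_product]
  rw [← Finset.card_sigma]
  symm
  have hsign : ∀ (B : Finset ι) (s : ℤ), s ∈ (if B = ∅ then {1} else {1, -1} : Finset ℤ) →
      s = 1 ∨ s = -1 := by
    intro B s hs
    split_ifs at hs <;> simp at hs <;> tauto
  refine Finset.card_bij
    (fun z _ i => if i ∈ z.1 then z.2.1 * ((m : ℤ) + 1) else z.2.2 i) ?_ ?_ ?_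
  · rintro ⟨B, s, y⟩ hz
    obtain ⟨hB, hz⟩ := Finset.mem_sigma.1 hz
    obtain ⟨hs, hy⟩ := Finset.mem_product.1 hz
    dsimp only at hB hs hy ⊢
    rw [Finset.mem_powerset] at hB
    rw [mem_sepSet] at hy ⊢
    obtain ⟨hy1, hy2, hy3⟩ := hy
    have hs' := hsign B s hs
    have hy1' := fun i => abs_le.1 (hy1 i)
    push_cast
    refine ⟨fun i => ?_, fun i hi => ?_, fun i hi j hj => ?_⟩
    · rw [abs_le]
      have := hy1' i
      split_ifs
      · rcases hs' with rfl | rfl <;> constructor <;> linarith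
      · constructor <;> linarith
    · rw [if_neg fun h => hi (hB h)]
      exact hy2 i fun h => hi (Finset.mem_sdiff.1 h).1
    · have h1 := hy1' i
      have h2 := hy1' j
      by_cases hiB : i ∈ B <;> by_cases hjB : j ∈ B <;> simp only [hiB, hjB, if_true, if_false]
      · rcases hs' with rfl | rfl <;> omega
      · rcases hs' with rfl | rfl <;> omega
      · rcases hs' with rfl | rfl <;> omega
      · exact hy3 i (Finset.mem_sdiff.2 ⟨hi, hiB⟩) j (Finset.mem_sdiff.2 ⟨hj, hjB⟩)
  · rintro ⟨B, s, y⟩ hz ⟨B', s', y'⟩ hz' h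
    obtain ⟨hB, hz⟩ := Finset.mem_sigma.1 hz
    obtain ⟨hs, hy⟩ := Finset.mem_product.1 hz
    obtain ⟨hB', hz'⟩ := Finset.mem_sigma.1 hz'
    obtain ⟨hs', hy'⟩ := Finset.mem_product.1 hz'
    dsimp only at hs hy hs' hy' h
    rw [mem_sepSet] at hy hy'
    have key := fun i => congrFun h i
    have hs1 := hsign B s hs
    have hs1' := hsign B' s' hs'
    have hBB : B = B' := by
      ext i
      have h1 := abs_le.1 (hy.1 i)
      have h2 := abs_le.1 (hy'.1 i)
      have h3 := key i
      by_cases hi : i ∈ B <;> by_cases hi' : i ∈ B' <;>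
        simp only [hi, hi', if_true, if_false] at h3 ⊢
      · rcases hs1 with rfl | rfl <;> omega
      · rcases hs1' with rfl | rfl <;> omega
    subst hBB
    have hss : s = s' := by
      by_cases hB0 : B = ∅
      · rw [if_pos hB0, Finset.mem_singleton] at hs hs'
        rw [hs, hs']
      · obtain ⟨i, hi⟩ := Finset.nonempty_iff_ne_empty.2 hB0
        have h3 := key i
        rw [if_pos hi, if_pos hi] at h3
        exact mul_right_cancel₀ (by positivity) h3
    have hyy : y = y' := by
      funext i
      by_cases hi : i ∈ B
      · rw [hy.2.1 i (by simp [hi]), hy'.2.1 i (by simp [hi])]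
      · have h3 := key i
        rwa [if_neg hi, if_neg hi] at h3
    rw [hss, hyy]
  · intro x hx
    rw [mem_sepSet] at hx
    obtain ⟨hx1, hx2, hx3⟩ := hx
    push_cast at hx1
    have hm : (0 : ℤ) < (m : ℤ) + 1 := by positivity
    set B := A.filter fun i => |x i| = (m : ℤ) + 1 with hB
    have hmem : ∀ i, i ∈ B ↔ |x i| = (m : ℤ) + 1 := by
      intro i
      rw [hB, Finset.mem_filter, and_iff_right_iff_imp]
      intro h
      by_contra hi
      rw [hx2 i hi, abs_zero] at h
      omega
    have hy : (fun i => if i ∈ B then 0 else x i) ∈ sepSet (A \ B) m := by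
      rw [mem_sepSet]
      refine ⟨fun i => ?_, fun i hi => ?_, fun i hi j hj => ?_⟩
      · split_ifs with h
        · simp
        · rw [hmem] at h
          have := hx1 i
          omega
      · split_ifs with h
        · rfl
        · exact hx2 i fun h' => hi (Finset.mem_sdiff.2 ⟨h', h⟩)
      · obtain ⟨hi1, hi2⟩ := Finset.mem_sdiff.1 hi
        obtain ⟨hj1, hj2⟩ := Finset.mem_sdiff.1 hj
        simp only [hi2, hj2, if_false]
        exact hx3 i hi1 j hj1
    obtain ⟨s, hs, hsB⟩ : ∃ s ∈ (if B = ∅ then {1} else {1, -1} : Finset ℤ),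
        ∀ i ∈ B, x i = s * ((m : ℤ) + 1) := by
      by_cases hB0 : B = ∅
      · exact ⟨1, by simp [hB0], by simp [hB0]⟩
      · obtain ⟨i, hi⟩ := Finset.nonempty_iff_ne_empty.2 hB0
        have hiA := (Finset.mem_filter.1 hi).1
        rcases (abs_eq hm.le).1 ((hmem i).1 hi) with h | h
        · refine ⟨1, by simp [hB0], fun j hj => ?_⟩
          have h3 := hx3 i hiA j (Finset.mem_filter.1 hj).1
          rcases (abs_eq hm.le).1 ((hmem j).1 hj) with h' | h' <;> omega
        · refine ⟨-1, by simp [hB0], fun j hj => ?_⟩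
          have h3 := hx3 i hiA j (Finset.mem_filter.1 hj).1
          rcases (abs_eq hm.le).1 ((hmem j).1 hj) with h' | h' <;> omega
    refine ⟨⟨B, s, fun i => if i ∈ B then 0 else x i⟩, Finset.mem_sigma.2
      ⟨Finset.mem_powerset.2 (Finset.filter_subset _ _), Finset.mem_product.2 ⟨hs, hy⟩⟩, ?_⟩
    funext i
    dsimp only
    split_ifs with h
    · exact (hsB i h).symm
    · rfl

/-- The factor (-1)^|A| replaces x by -x in (2e^x - 1)^m. -/
theorem card_sepSet_eq_egfCoeff (m : ℕ) (A : Finset ι) :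
    (-1) ^ A.card * ((sepSet A m).card : ℚ) = egfCoeff (blockSeries ^ m) A.card := by
  induction m generalizing A with
  | zero =>
    rw [card_sepSet_zero, pow_zero, egfCoeff, PowerSeries.coeff_one]
    rcases A.eq_empty_or_nonempty with rfl | hA
    · simp
    · simp [hA.ne_empty]
  | succ m ih =>
    rw [card_sepSet_succ, pow_succ', egfCoeff_mul]
    push_cast
    rw [Finset.mul_sum]
    refine Finset.sum_congr rfl fun B hB => ?_
    have hc := Finset.card_sdiff_add_card_eq_card (Finset.mem_powerset.1 hB)
    rw [← ih, egfCoeff_blockSeries, ← hc, pow_add]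
    simp only [Finset.card_eq_zero]
    ring

/-- The points of the box that lie on no hyperplane `x_i + x_j = 0`, `i ≠ j`. -/
noncomputable def boxComplement (ι : Type*) [Fintype ι] [DecidableEq ι] (m : ℕ) : Finset (ι → ℤ) :=
  {x ∈ intBox ι m | ∀ i j, i ≠ j → x i + x j ≠ 0}

/-- Two zero coordinates would sum to zero, so at most one vanishes; the second summand runs over
its position. -/
theorem card_boxComplement (m : ℕ) : (boxComplement ι m).card =
    (sepSet (Finset.univ : Finset ι) m).card +
      ∑ i : ι, (sepSet (Finset.univ.erase i) m).card := by
  have h : boxComplement ι m = sepSet Finset.univ m ∪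
      Finset.univ.biUnion fun i : ι => sepSet (Finset.univ.erase i) m := by
    ext x
    simp only [boxComplement, Finset.mem_filter, mem_intBox, Finset.mem_union, Finset.mem_biUnion,
      mem_sepSet, Finset.mem_univ, true_and, Finset.mem_erase, and_true, not_not, ne_eq,
      not_true_eq_false, false_implies, implies_true, forall_const]
    constructor
    · rintro ⟨h1, h2⟩
      by_cases hz : ∃ i, x i = 0
      · obtain ⟨i, hi⟩ := hz
        refine Or.inr ⟨i, h1, fun j hj => hj ▸ hi, fun j hj k hk => ?_⟩
        by_cases hjk : j = k
        · subst hjk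
          have := h2 i j (Ne.symm hj)
          omega
        · exact h2 j k hjk
      · refine Or.inl ⟨h1, fun j k => ?_⟩
        by_cases hjk : j = k
        · subst hjk
          have : x j ≠ 0 := fun h => hz ⟨j, h⟩
          omega
        · exact h2 j k hjk
    · rintro (⟨h1, h2⟩ | ⟨i, h1, h2, h3⟩)
      · exact ⟨h1, fun j k _ => h2 j k⟩
      · refine ⟨h1, fun j k hjk => ?_⟩
        have hi := h2 i rfl
        by_cases hj : j = i
        · subst hj
          have := h3 k (Ne.symm hjk) k (Ne.symm hjk)
          omega
        · by_cases hk : k = i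
          · subst hk
            have := h3 j hj j hj
            omega
          · exact h3 j hj k hk
  have hne : ∀ {A : Finset ι} {x : ι → ℤ}, x ∈ sepSet A m → ∀ i ∈ A, x i ≠ 0 := by
    intro A x hx i hi h0
    exact (mem_sepSet.1 hx).2.2 i hi i hi (by simp [h0])
  rw [h, Finset.card_union_of_disjoint, Finset.card_biUnion]
  · intro i _ j _ hij
    refine Finset.disjoint_left.2 fun x hx hx' => ?_
    exact hne hx' i (by simp [hij]) ((mem_sepSet.1 hx).2.1 i (by simp))
  · refine Finset.disjoint_left.2 fun x hx hx' => ?_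
    obtain ⟨i, -, hi⟩ := Finset.mem_biUnion.1 hx'
    exact hne hx i (Finset.mem_univ i) ((mem_sepSet.1 hi).2.1 i (by simp))

end BoxCount

/-! ### Solved form of the equations of a flat -/

section SignedRepresentation

variable {ι : Type*}

/-- The system of equations `x i = ε i * x (f i)` is in solved form: its free variables are the `s`
with `f s = s` and `ε s = 1`. -/
structure IsSolvedForm (f : ι → ι) (ε : ι → ℤ) : Prop where
  sign : ∀ i, ε i = 0 ∨ ε i = 1 ∨ ε i = -1
  root : ∀ i, ε i ≠ 0 → f (f i) = f i ∧ ε (f i) = 1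

/-- `V` is the solution set of a system in solved form. -/
def HasSolvedForm (V : Set (ι → ℝ)) : Prop :=
  ∃ (f : ι → ι) (ε : ι → ℤ), IsSolvedForm f ε ∧ ∀ x, x ∈ V ↔ ∀ i, x i = ε i * x (f i)

theorem HasSolvedForm.univ : HasSolvedForm (Set.univ : Set (ι → ℝ)) :=
  ⟨id, fun _ => 1, ⟨fun _ => Or.inr (Or.inl rfl), fun _ _ => ⟨rfl, rfl⟩⟩, by simp⟩

theorem IsSolvedForm.hasSolvedForm_eq_zero {f : ι → ι} {ε : ι → ℤ} (h : IsSolvedForm f ε)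
    {q : ι} (hq : f q = q) :
    HasSolvedForm {x : ι → ℝ | (∀ i, x i = ε i * x (f i)) ∧ x q = 0} := by
  classical
  refine ⟨f, fun i => if f i = q then 0 else ε i, ⟨fun i => ?_, fun i hi => ?_⟩, fun x => ?_⟩
  · split_ifs
    · exact Or.inl rfl
    · exact h.sign i
  · split_ifs at hi with hiq
    · exact absurd rfl hi
    · obtain ⟨h1, h2⟩ := h.root i hi
      exact ⟨h1, by rw [h1, if_neg hiq, h2]⟩
  · constructor
    · rintro ⟨h1, h2⟩ i
      dsimp only
      split_ifs with hiq
      · rw [h1 i, hiq, h2]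
        simp
      · exact h1 i
    · intro h1
      dsimp only at h1
      have h2 : x q = 0 := by
        have := h1 q
        rw [if_pos hq] at this
        simpa using this
      refine ⟨fun i => ?_, h2⟩
      have := h1 i
      split_ifs at this with hiq
      · rw [this, hiq, h2]
        simp
      · exact this

theorem IsSolvedForm.hasSolvedForm_eq_mul {f : ι → ι} {ε : ι → ℤ} (h : IsSolvedForm f ε)
    {p q : ι} (hpq : p ≠ q) (hp : f p = p) (hp1 : ε p = 1) (hq : f q = q) (hq1 : ε q = 1) {c : ℤ}
    (hc : c = 1 ∨ c = -1) :
    HasSolvedForm {x : ι → ℝ | (∀ i, x i = ε i * x (f i)) ∧ x p = c * x q} := by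
  classical
  refine ⟨fun i => if f i = p then q else f i, fun i => if f i = p then c * ε i else ε i,
    ⟨fun i => ?_, fun i hi => ?_⟩, fun x => ?_⟩
  · split_ifs
    · rcases hc with rfl | rfl <;> rcases h.sign i with h | h | h <;> simp [h]
    · exact h.sign i
  · by_cases hip : f i = p
    · rw [if_pos hip, hq, if_neg hpq.symm, if_neg hpq.symm]
      exact ⟨rfl, hq1⟩
    · rw [if_neg hip] at hi ⊢
      obtain ⟨h1, h2⟩ := h.root i hi
      rw [h1, if_neg hip, if_neg hip]
      exact ⟨rfl, h2⟩
  · constructor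
    · rintro ⟨h1, h2⟩ i
      dsimp only
      split_ifs with hip
      · rw [h1 i, hip, h2]
        push_cast
        ring
      · exact h1 i
    · intro h1
      dsimp only at h1
      have h2 : x p = c * x q := by
        have := h1 p
        rw [if_pos hp, if_pos hp, hp1, mul_one] at this
        exact this
      refine ⟨fun i => ?_, h2⟩
      have := h1 i
      split_ifs at this with hip
      · rw [this, hip, h2]
        push_cast
        ring
      · exact this

/-- After substitution the new equation involves at most two free variables: it is trivial, makes
one of them zero, or equates one with plus or minus the other. -/
theorem HasSolvedForm.inter_add_eq_zero {V : Set (ι → ℝ)} (hV : HasSolvedForm V) (a b : ι) :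
    HasSolvedForm (V ∩ {x | x a + x b = 0}) := by
  obtain ⟨f, ε, h, hx⟩ := hV
  have key : ∀ P : (ι → ℝ) → Prop,
      (∀ x : ι → ℝ, (∀ i, x i = ε i * x (f i)) → (x a + x b = 0 ↔ P x)) →
      HasSolvedForm {x | (∀ i, x i = ε i * x (f i)) ∧ P x} →
      HasSolvedForm (V ∩ {x | x a + x b = 0}) := by
    intro P hP hs
    convert hs using 1
    ext x
    simp only [Set.mem_inter_iff, Set.mem_ofPred_eq, hx]
    exact and_congr_right fun hx' => hP x hx'
  have htriv : HasSolvedForm {x : ι → ℝ | (∀ i, x i = ε i * x (f i)) ∧ True} :=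
    ⟨f, ε, h, by simp⟩
  have hroot : ∀ i, ε i = 1 ∨ ε i = -1 → f (f i) = f i ∧ ε (f i) = 1 := fun i hi =>
    h.root i (by rcases hi with hi | hi <;> simp [hi])
  rcases h.sign a with ha | ha
  · rcases h.sign b with hb | hb
    · refine key _ (fun x hx => ?_) htriv
      rw [hx a, hx b, ha, hb]
      simp
    · refine key _ (fun x hx => ?_) (h.hasSolvedForm_eq_zero (hroot b hb).1)
      rw [hx a, hx b, ha]
      rcases hb with hb | hb <;> simp [hb]
  · rcases h.sign b with hb | hb
    · refine key _ (fun x hx => ?_) (h.hasSolvedForm_eq_zero (hroot a ha).1)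
      rw [hx a, hx b, hb]
      rcases ha with ha | ha <;> simp [ha]
    · by_cases hab : f a = f b
      · by_cases he : ε a = ε b
        · refine key _ (fun x hx => ?_) (h.hasSolvedForm_eq_zero (hroot b hb).1)
          rw [hx a, hx b, he, hab]
          rcases hb with hb | hb <;> simp [hb]
        · refine key _ (fun x hx => ?_) htriv
          have he' : ε a = -ε b := by
            rcases ha with ha | ha <;> rcases hb with hb | hb <;> rw [ha, hb] at he ⊢ <;> simp at he ⊢
          rw [hx a, hx b, he', hab]
          simp
      -- Solve ε a * x (f a) + ε b * x (f b) = 0 for x (f a), using that ε a is its own inverse.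
      · refine key _ (fun x hx => ?_) (h.hasSolvedForm_eq_mul hab (hroot a ha).1 (hroot a ha).2
          (hroot b hb).1 (hroot b hb).2 (c := -(ε a * ε b)) ?_)
        · rw [hx a, hx b]
          rcases ha with ha | ha <;> rcases hb with hb | hb <;> rw [ha, hb] <;> push_cast <;>
            constructor <;> intro h <;> linarith
        · rcases ha with ha | ha <;> rcases hb with hb | hb <;> simp [ha, hb]

theorem hasSolvedForm_of_finset (E : Finset (ι × ι)) :
    HasSolvedForm {x : ι → ℝ | ∀ e ∈ E, x e.1 + x e.2 = 0} := by
  classical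
  induction E using Finset.induction_on with
  | empty => simpa using HasSolvedForm.univ
  | insert e E _ ih =>
    convert ih.inter_add_eq_zero e.1 e.2 using 1
    ext x
    simp only [Finset.mem_insert, forall_eq_or_imp, Set.mem_ofPred_eq, Set.mem_inter_iff]
    exact and_comm

namespace IsSolvedForm

variable {f : ι → ι} {ε : ι → ℤ}

/-- The solution of a system in solved form with given values of the free variables. -/
def extend (h : IsSolvedForm f ε) {R : Type*} [Ring R]
    (y : {s // f s = s ∧ ε s = 1} → R) (i : ι) : R :=
  if hi : ε i = 0 then 0 else ε i * y ⟨f i, h.root i hi⟩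

theorem extend_root (h : IsSolvedForm f ε) {R : Type*} [Ring R]
    (y : {s // f s = s ∧ ε s = 1} → R)
    (s : {s // f s = s ∧ ε s = 1}) : h.extend y s = y s := by
  have hs : ε s ≠ 0 := by simp [s.2.2]
  rw [extend, dif_neg hs, s.2.2, Int.cast_one, one_mul]
  exact congrArg y (Subtype.ext s.2.1)

theorem extend_eq (h : IsSolvedForm f ε) {R : Type*} [Ring R]
    (y : {s // f s = s ∧ ε s = 1} → R) (i : ι) :
    h.extend y i = ε i * h.extend y (f i) := by
  by_cases hi : ε i = 0
  · simp [extend, hi]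
  · rw [h.extend_root y ⟨f i, h.root i hi⟩, extend, dif_neg hi]

theorem ext_of_root (h : IsSolvedForm f ε) {R : Type*} [Ring R] {x x' : ι → R}
    (hx : ∀ i, x i = ε i * x (f i))
    (hx' : ∀ i, x' i = ε i * x' (f i)) (hs : ∀ s, f s = s → ε s = 1 → x s = x' s) : x = x' := by
  funext i
  rw [hx, hx']
  by_cases hi : ε i = 0
  · simp [hi]
  · rw [hs (f i) (h.root i hi).1 (h.root i hi).2]

theorem finrank_eq (h : IsSolvedForm f ε) [Fintype ι] [DecidableEq ι]
    (V : Submodule ℝ (ι → ℝ))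
    (hV : ∀ x, x ∈ V ↔ ∀ i, x i = ε i * x (f i)) :
    Module.finrank ℝ V = Fintype.card {s // f s = s ∧ ε s = 1} := by
  have hbij : Function.Bijective ((LinearMap.funLeft ℝ ℝ
      (Subtype.val : {s // f s = s ∧ ε s = 1} → ι)).comp V.subtype) := by
    constructor
    · rintro ⟨x, hx⟩ ⟨x', hx'⟩ hxx
      refine Subtype.ext (h.ext_of_root ((hV x).1 hx) ((hV x').1 hx') fun s h1 h2 => ?_)
      exact congrFun hxx ⟨s, h1, h2⟩
    · intro y
      exact ⟨⟨h.extend y, (hV _).2 (h.extend_eq y)⟩, funext fun s => h.extend_root y s⟩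
  rw [(LinearEquiv.ofBijective _ hbij).finrank_eq, Module.finrank_fintype_fun_eq_card]

/-- Coefficients 0, 1 and -1 never increase absolute values, so the free coordinates range
independently over the 2m + 1 integers of [-m, m]. -/
theorem card_filter_intBox (h : IsSolvedForm f ε) [Fintype ι] [DecidableEq ι] (m : ℕ) :
    ((intBox ι m).filter fun x => ∀ i, x i = ε i * x (f i)).card =
      (2 * m + 1) ^ Fintype.card {s // f s = s ∧ ε s = 1} := by
  have h1 : (intBox {s // f s = s ∧ ε s = 1} m).card =
      (2 * m + 1) ^ Fintype.card {s // f s = s ∧ ε s = 1} := by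
    rw [intBox, Fintype.card_piFinset, Finset.prod_const, Int.card_Icc, Finset.card_univ]
    congr 1
    omega
  rw [← h1]
  refine Finset.card_bij (fun x _ s => x s.1) ?_ ?_ ?_
  · intro x hx
    rw [Finset.mem_filter, mem_intBox] at hx
    exact mem_intBox.2 fun s => hx.1 s
  · intro x hx x' hx' hxx
    exact h.ext_of_root (Finset.mem_filter.1 hx).2 (Finset.mem_filter.1 hx').2
      fun s h1 h2 => congrFun hxx ⟨s, h1, h2⟩
  · intro y hy
    rw [mem_intBox] at hy
    refine ⟨h.extend y, Finset.mem_filter.2 ⟨mem_intBox.2 fun i => ?_, h.extend_eq y⟩,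
      funext fun s => h.extend_root y s⟩
    by_cases hi : ε i = 0
    · simp [extend, hi]
    · rw [extend, dif_neg hi]
      have := hy ⟨f i, h.root i hi⟩
      rcases (h.sign i).resolve_left hi with h1 | h1 <;> simpa [h1] using this

end IsSolvedForm

end SignedRepresentation

/-! ### Evaluating the characteristic polynomial -/

namespace HyperplaneArrangement

variable {n : ℕ} (A : HyperplaneArrangement n)

-- The flats through `x` form the interval from the whole space to the intersection of all
-- hyperplanes through `x`. The Möbius function sums to 0 over it unless it is a single point.
open Classical in
theorem sum_mu_of_mem (x : Fin n → ℝ) :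
    ∑ X : A.IntersectionPoset with x ∈ OrderDual.ofDual X.1, IncidenceAlgebra.mu ℤ ⊥ X =
      if ∃ H ∈ A.hyperplanes, x ∈ H then 0 else 1 := by
  set C := {H ∈ A.hyperplanes | x ∈ H} with hC
  have hx : x ∈ sInf C := by
    rw [AffineSubspace.mem_sInf_iff]
    exact fun H hH => hH.2
  set F : A.IntersectionPoset :=
    ⟨OrderDual.toDual (sInf C), ⟨x, hx⟩, C, fun H hH => hH.1, rfl⟩ with hF
  have h1 : (Finset.univ.filter fun X : A.IntersectionPoset => x ∈ OrderDual.ofDual X.1) =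
      Finset.Icc ⊥ F := by
    ext X
    rw [Finset.mem_filter, Finset.mem_Icc]
    simp only [Finset.mem_univ, true_and, bot_le]
    constructor
    · intro hX
      obtain ⟨X, hne, B, hB, hXB⟩ := X
      change sInf C ≤ OrderDual.ofDual X
      change x ∈ OrderDual.ofDual X at hX
      rw [hXB] at hX ⊢
      exact sInf_le_sInf fun H hH => ⟨hB hH, (AffineSubspace.mem_sInf_iff _ _).1 hX H hH⟩
    · intro hX
      have : sInf C ≤ OrderDual.ofDual X.1 := hX
      exact this hx
  rw [h1, IncidenceAlgebra.sum_Icc_mu_right]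
  have h2 : (⊥ = F) ↔ ¬ ∃ H ∈ A.hyperplanes, x ∈ H := by
    constructor
    · rintro h ⟨H, hH, hxH⟩
      have h3 : (⊤ : AffineSubspace ℝ (Fin n → ℝ)) = sInf C :=
        congrArg (fun X : A.IntersectionPoset => OrderDual.ofDual X.1) h
      have h4 : H = ⊤ := top_le_iff.1 (h3 ▸ sInf_le ⟨hH, hxH⟩)
      have h5 := A.finrank_add_one_of_mem H hH
      rw [h4, AffineSubspace.direction_top, finrank_top, Module.finrank_fin_fun] at h5
      omega
    · intro h
      have h3 : C = ∅ := Set.eq_empty_of_forall_notMem fun H hH => h ⟨H, hH.1, hH.2⟩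
      refine Subtype.ext ?_
      change OrderDual.toDual ⊤ = OrderDual.toDual (sInf C)
      rw [h3, sInf_empty]
  rw [if_congr h2 rfl rfl, ite_not]

end HyperplaneArrangement

theorem mem_sumZeroSubspace {n : ℕ} {i j : Fin n} {x : Fin n → ℝ} :
    x ∈ sumZeroSubspace i j ↔ x i + x j = 0 := by
  simp [sumZeroSubspace, sumForm]

open Classical in
theorem card_intBox_filter_flat {n : ℕ} {X : AffineSubspace ℝ (Fin n → ℝ)}
    (hX : (thresholdArrangement n).IsFlat X) (m : ℕ) :
    ((intBox (Fin n) m).filter fun x => (fun i => (x i : ℝ)) ∈ X).card =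
      (2 * m + 1) ^ Module.finrank ℝ X.direction := by
  obtain ⟨-, B, hB, rfl⟩ := hX
  set E : Finset (Fin n × Fin n) :=
    Finset.univ.filter fun e => sumZeroSubspace e.1 e.2 ∈ B with hE
  have hmem : ∀ x, x ∈ sInf B ↔ ∀ e ∈ E, x e.1 + x e.2 = 0 := by
    intro x
    rw [AffineSubspace.mem_sInf_iff]
    constructor
    · intro h e he
      exact mem_sumZeroSubspace.1 (h _ (Finset.mem_filter.1 he).2)
    · intro h H hH
      obtain ⟨i, j, -, rfl⟩ := hB hH
      exact mem_sumZeroSubspace.2 (h (i, j) (Finset.mem_filter.2 ⟨Finset.mem_univ _, hH⟩))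
  obtain ⟨f, ε, h, hsol⟩ := hasSolvedForm_of_finset E
  have hsol' : ∀ x, x ∈ sInf B ↔ ∀ i, x i = ε i * x (f i) := fun x =>
    (hmem x).trans (hsol x)
  -- The flat contains the origin, so its direction has the same equations.
  have h0 : (0 : Fin n → ℝ) ∈ sInf B := (hmem 0).2 (by simp)
  have hdir : ∀ x, x ∈ (sInf B).direction ↔ ∀ i, x i = ε i * x (f i) := by
    intro x
    rw [← AffineSubspace.vadd_mem_iff_mem_direction x h0, vadd_eq_add, add_zero, hsol']
  rw [h.finrank_eq _ hdir]
  rw [← h.card_filter_intBox m]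
  congr 1
  ext x
  simp only [Finset.mem_filter, hsol']
  refine and_congr_right fun _ => ?_
  exact forall_congr' fun i => by exact_mod_cast Iff.rfl

/-- Replace each power of 2m + 1 by a count of box points on the flat and exchange the sums; each
point then contributes its Möbius sum. -/
theorem eval_charPoly_thresholdArrangement (n m : ℕ) :
    (thresholdArrangement n).charPoly.eval (2 * (m : ℤ) + 1) = (boxComplement (Fin n) m).card := by
  classical
  rw [HyperplaneArrangement.charPoly, Polynomial.eval_finsetSum]
  have h1 : ∀ X : (thresholdArrangement n).IntersectionPoset,
      (Polynomial.C (IncidenceAlgebra.mu ℤ ⊥ X) *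
        Polynomial.X ^ Module.finrank ℝ (OrderDual.ofDual X.1).direction).eval (2 * (m : ℤ) + 1) =
      ∑ x ∈ intBox (Fin n) m, if (fun i => (x i : ℝ)) ∈ OrderDual.ofDual X.1 then
        IncidenceAlgebra.mu ℤ ⊥ X else 0 := by
    intro X
    have h2 := card_intBox_filter_flat X.2 m
    rw [← Finset.sum_filter, Finset.sum_const, h2, nsmul_eq_mul]
    simp [mul_comm]
  rw [Finset.sum_congr rfl fun X _ => h1 X, Finset.sum_comm]
  simp_rw [← Finset.sum_filter]
  rw [Finset.sum_congr rfl fun x _ =>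
    (thresholdArrangement n).sum_mu_of_mem fun i => (x i : ℝ), boxComplement,
    Finset.card_filter]
  push_cast
  refine Finset.sum_congr rfl fun x _ => ?_
  rw [← ite_not]
  refine if_congr ?_ rfl rfl
  constructor
  · intro h i j hij h0
    have h0' : ((x i : ℝ) + x j) = 0 := by exact_mod_cast h0
    rcases lt_or_gt_of_ne hij with hlt | hlt
    · exact h ⟨_, ⟨i, j, hlt, rfl⟩, mem_sumZeroSubspace.2 h0'⟩
    · exact h ⟨_, ⟨j, i, hlt, rfl⟩, mem_sumZeroSubspace.2 (by rwa [add_comm])⟩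
  · rintro h ⟨_, ⟨i, j, hij, rfl⟩, hx⟩
    exact h i j hij.ne (by exact_mod_cast mem_sumZeroSubspace.1 hx)

/-! ### Comparison at negative odd integers -/

/-- The generating polynomial of the number of odd compartments over the normal words on `A`. -/
noncomputable def wordPoly {α : Type*} [LinearOrder α] [Fintype α] (A : Finset α) :
    Polynomial ℤ :=
  ∑ l ∈ words A, Polynomial.X ^ oddAux 1 l

theorem polynomial_ext_of_odd {P Q : Polynomial ℤ}
    (h : ∀ m : ℕ, P.eval (-(2 * (m : ℤ) + 1)) = Q.eval (-(2 * (m : ℤ) + 1))) : P = Q := by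
  refine Polynomial.eq_of_infinite_eval_eq P Q ?_
  refine (Set.infinite_range_of_injective (f := fun m : ℕ => -(2 * (m : ℤ) + 1)) ?_).mono ?_
  · intro a b hab
    dsimp only at hab
    omega
  · rintro _ ⟨m, rfl⟩
    exact h m

section

variable {α : Type*} [LinearOrder α] [Fintype α]

theorem cast_eval_wordPoly (A : Finset α) (t : ℤ) :
    (((wordPoly A).eval t : ℤ) : ℚ) = wordSum (t : ℚ) A := by
  rw [wordPoly, Polynomial.eval_finsetSum, wordSum]
  push_cast
  simp

theorem cast_eval_wordPoly_odd (A : Finset α) (m : ℕ) :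
    (((wordPoly A).eval (-(2 * (m : ℤ) + 1)) : ℤ) : ℚ) = egfCoeff (blockSeries ^ m) A.card := by
  rw [cast_eval_wordPoly, ← wordSum_eq_egfCoeff]
  push_cast
  rfl

theorem eval_wordPoly_odd (A : Finset α) (m : ℕ) :
    (wordPoly A).eval (-(2 * (m : ℤ) + 1)) = (-1) ^ A.card * (sepSet A m).card := by
  have h := cast_eval_wordPoly_odd A m
  rw [← card_sepSet_eq_egfCoeff] at h
  exact_mod_cast h

/-- No relabelling of letters is needed: the values at all -(2m+1) depend only on the number of
letters. -/
theorem wordPoly_eq_of_card_eq {β : Type*} [LinearOrder β] [Fintype β] {A : Finset α}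
    {B : Finset β} (h : A.card = B.card) : wordPoly A = wordPoly B :=
  polynomial_ext_of_odd fun m => by
    have h1 := cast_eval_wordPoly_odd A m
    rw [h, ← cast_eval_wordPoly_odd] at h1
    exact_mod_cast h1

theorem coeff_wordPoly (A : Finset α) (j : ℕ) :
    (wordPoly A).coeff j = (((words A).filter fun l => oddAux 1 l = j).card : ℤ) := by
  rw [wordPoly, Polynomial.finsetSum_coeff, Finset.card_filter]
  push_cast
  exact Finset.sum_congr rfl fun l _ => by simp [Polynomial.coeff_X_pow, eq_comm]

end

/-- The generating polynomial of the number of odd cycles over the threshold permutations. -/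
noncomputable def thresholdPoly (n : ℕ) : Polynomial ℤ :=
  wordPoly (Finset.univ : Finset (Fin n)) - ∑ a : Fin n, wordPoly (Finset.univ.erase a)

theorem coeff_thresholdPoly (n j : ℕ) : (thresholdPoly n).coeff j = thresholdCount n j := by
  classical
  rw [thresholdCount_eq_card, ← Finset.filter_filter, Finset.card_filter]
  have h := sum_not_isThresholdWord (Finset.univ : Finset (Fin n)) fun k => if k = j then (1 : ℤ) else 0
  have h2 := Finset.sum_filter_add_sum_filter_not (words (Finset.univ : Finset (Fin n)))
    IsThresholdWord fun l => if oddAux 1 l = j then (1 : ℤ) else 0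
  have h3 : ∀ A : Finset (Fin n), (wordPoly A).coeff j =
      ∑ l ∈ words A, if oddAux 1 l = j then (1 : ℤ) else 0 := fun A => by
    rw [coeff_wordPoly, Finset.card_filter]
    push_cast
    rfl
  rw [thresholdPoly, Polynomial.coeff_sub, Polynomial.finsetSum_coeff]
  simp_rw [h3]
  rw [← h, ← h2]
  push_cast
  ring

theorem thresholdCount_eq_sub (n j : ℕ) :
    (thresholdCount n j : ℤ) = (normalCount n j : ℤ) - (n : ℤ) * (normalCount (n - 1) j : ℤ) := by
  have h1 : ∀ k : ℕ, (normalCount k j : ℤ) =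
      (wordPoly (Finset.univ : Finset (Fin k))).coeff j := fun k => by
    rw [normalCount_eq_card, coeff_wordPoly]
  have h2 : ∀ a : Fin n, wordPoly (Finset.univ.erase a) =
      wordPoly (Finset.univ : Finset (Fin (n - 1))) := fun a =>
    wordPoly_eq_of_card_eq (by simp)
  rw [← coeff_thresholdPoly, thresholdPoly, Polynomial.coeff_sub, Finset.sum_congr rfl fun a _ => h2 a,
    Finset.sum_const, h1, h1]
  simp

/-- Words with one letter removed carry the sign (-1)^(n-1), which turns the minus in
`thresholdPoly` into the plus of `card_boxComplement`. -/
theorem charPoly_comp_neg (n : ℕ) :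
    (thresholdArrangement n).charPoly.comp (-Polynomial.X) = (-1) ^ n * thresholdPoly n := by
  refine polynomial_ext_of_odd fun m => ?_
  rw [Polynomial.eval_comp, Polynomial.eval_neg, Polynomial.eval_X, neg_neg,
    eval_charPoly_thresholdArrangement, card_boxComplement, thresholdPoly, Polynomial.eval_mul,
    Polynomial.eval_sub, Polynomial.eval_finsetSum, eval_wordPoly_odd, Finset.card_univ,
    Fintype.card_fin]
  have h1 : ∀ a : Fin n, (wordPoly (Finset.univ.erase a)).eval (-(2 * (m : ℤ) + 1)) =
      -((-1) ^ n * (sepSet (Finset.univ.erase a) m).card) := by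
    intro a
    have hc := Finset.card_erase_add_one (Finset.mem_univ a)
    rw [Finset.card_univ, Fintype.card_fin] at hc
    have hp : (-1 : ℤ) ^ n = (-1) ^ (Finset.univ.erase a).card * (-1) := by rw [← pow_succ, hc]
    rw [eval_wordPoly_odd, hp]
    ring
  rw [Finset.sum_congr rfl fun a _ => h1 a, Finset.sum_neg_distrib, ← Finset.mul_sum]
  have h2 : ((-1 : Polynomial ℤ) ^ n).eval (-(2 * (m : ℤ) + 1)) = (-1) ^ n := by simp
  have h3 : ((-1 : ℤ) ^ n) * (-1) ^ n = 1 := by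
    rw [← mul_pow]
    simp
  rw [h2]
  push_cast
  linear_combination (-((sepSet (Finset.univ : Finset (Fin n)) m).card : ℤ) -
    ∑ a : Fin n, ((sepSet (Finset.univ.erase a) m).card : ℤ)) * h3

theorem abs_coeff_charPoly (n j : ℕ) :
    |(thresholdArrangement n).charPoly.coeff j| = (thresholdCount n j : ℤ) := by
  have h := congrArg (fun P => |Polynomial.coeff P j|) (charPoly_comp_neg n)
  have hX : (-Polynomial.X : Polynomial ℤ) = Polynomial.C (-1) * Polynomial.X := by simp
  rw [hX, Polynomial.comp_C_mul_X_coeff, mul_comm, abs_mul, abs_pow, abs_neg, abs_one, one_pow, one_mul] at h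
  have hC : ((-1 : Polynomial ℤ) ^ n) = Polynomial.C ((-1) ^ n) := by simp
  rw [h, hC, Polynomial.coeff_C_mul, coeff_thresholdPoly, abs_mul, abs_pow, abs_neg, abs_one,
    one_pow, one_mul, Nat.abs_cast]

theorem mainTheorem2 (n j : ℕ) :
    |(thresholdArrangement n).charPoly.coeff j| = (thresholdCount n j : ℤ) ∧
    (thresholdCount n j : ℤ) = (normalCount n j : ℤ) - (n : ℤ) * (normalCount (n - 1) j : ℤ) :=
  ⟨abs_coeff_charPoly n j, thresholdCount_eq_sub n j⟩
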